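/- Let $S=\mathrm{diag}(s_1,s_2,s_3)$ with $0<s_1<s_2<s_3$ and $s_1+s_2+s_3=1$, and let $K(S)=\{\lambda R^tSR:\lambda\in\mathbb R,\ R\in SO(3)\}$. Let $K^{app}(S)$ be the set of symmetric real $3\times3$ matrices $A$ for which there is a sequence $u_j\in W^{1,2}_{loc}(\mathbb R^3;\mathbb R^3)$, with $u_j-Ax$ periodic with period cell $[0,1]^3$, that is bounded in $W^{1,2}_{loc}$, such that $\{\nabla u_j\}$ is $L^2_{loc}$-equi-integrable and $\mathrm{dist}(\nabla u_j,K(S))\to0$ locally in measure. Let $K^*(S)$ be the set of diagonal matrices $\mathrm{diag}(a_1,a_2,a_3)\in K^{app}(S)$ with $a_i\in[s_1,s_3]$ for all $i$ and $a_1+a_2+a_3=1$. Set $F(x,y)=\dfrac{s_1s_3}{s_2}\cdot\dfrac{xy}{x^2+xy+y^2-s_2(x+y)}$. Let $\mathcal T^2(S)$ be the set of diagonal matrices $T$ of trace one whose eigenvalues $t_1\le t_2\le t_3$ lie in $[s_1,s_3]$ and satisfy at least one of $$(\alpha)\quad \max\Big(\frac{t_1}{s_2},\frac{t_2}{s_3}\Big)=\frac{t_1}{s_2},\quad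 \min\Big(\frac{t_2}{s_2},\frac{t_3}{s_3}\Big)=\frac{t_2}{s_2},\quad t_3=F(t_1,t_2);$$ $$(\beta)\quad \max\Big(\frac{t_1}{s_1},\frac{t_2}{s_2}\Big)=\frac{t_2}{s_2},\quad \min\Big(\frac{t_2}{s_1},\frac{t_3}{s_2}\Big)=\frac{t_3}{s_2},\quad t_1=F(t_3,t_2).$$ Let $T\in\mathcal T^2(S)$, and let $(\lambda_1,\lambda_2)=(t_1/s_2,\,t_2/s_2)$ if $(\alpha)$ holds and $(\lambda_1,\lambda_2)=(t_3/s_2,\,t_2/s_2)$ if $(\beta)$ holds (either choice is allowed if both hold). Then there exist $R_1,R_2\in SO(3)$ and a unit vector $n\in\mathbb R^3$ such that $$R_1^tTR_1=\lambda_1S+(1-\lambda_1)\,n\otimes n,\qquad R_2^tTR_2=\lambda_2S+(1-\lambda_2)\,n\otimes n,\qquad(*)$$ and for all $R_1,R_2\in SO(3)$ and all unit vectors $n$ satisfying $(*)$, and every $A$ in the closed segment $[\lambda_1S,\,R_1^tTR_1]$, there is $R\in SO(3)$ such that $\dfrac{1}{\mathrm{Tr}\,A}R^tAR\in K^*(S)$.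 -/

import Mathlib

open MeasureTheory Filter Topology
open scoped Matrix ContDiff NNReal Matrix.Norms.Frobenius

/-- Three-dimensional Euclidean space. -/
abbrev E3 : Type := EuclideanSpace ℝ (Fin 3)

/-- Real `3 × 3` matrices; their norm and distance are the Frobenius ones. -/
abbrev M3 : Type := Matrix (Fin 3) (Fin 3) ℝ

/-- The rotation group `SO(3)`. -/
abbrev SO3 : Submonoid M3 := Matrix.specialOrthogonalGroup (Fin 3) ℝ

/-- The tensor square `n ⊗ n`. -/
def tensorSq (n : E3) : M3 := Matrix.vecMulVec n.ofLp n.ofLp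

/-- `K(S) = {l Rᵗ S R : l ∈ ℝ, R ∈ SO(3)}`. -/
def KSet (S : M3) : Set M3 :=
  {M | ∃ l : ℝ, ∃ R ∈ SO3, M = l • (Rᵀ * S * R)}

/-! ### The Sobolev spaces -/

/-- `G` is the weak (distributional) gradient of `u`, with `G x i k` standing for `∂ₖ uᵢ (x)`. -/
def HasWeakGradient (u : E3 → E3) (G : E3 → M3) : Prop :=
  LocallyIntegrable u ∧ (∀ i k : Fin 3, LocallyIntegrable (fun x => G x i k)) ∧
    ∀ φ : E3 → ℝ, ContDiff ℝ ∞ φ → HasCompactSupport φ → ∀ i k : Fin 3,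
      ∫ x, u x i * fderiv ℝ φ x (EuclideanSpace.single k 1) = -∫ x, G x i k * φ x

/-- `u ∈ W^{1,2}_loc(ℝ³; ℝ³)`, with weak gradient `G`. -/
def MemW12Loc (u : E3 → E3) (G : E3 → M3) : Prop :=
  HasWeakGradient u G ∧
    ∀ Q : Set E3, IsCompact Q →
      MemLp u 2 (volume.restrict Q) ∧
        ∀ i k : Fin 3, MemLp (fun x => G x i k) 2 (volume.restrict Q)

/-- `v` is `[0,1]³`-periodic (as an element of a space of classes of a.e. equal functions). -/
def IsCellPeriodic (v : E3 → E3) : Prop :=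
  ∀ i : Fin 3, ∀ᵐ x, v (x + EuclideanSpace.single i 1) = v x

/-- The linear field `x ↦ A x`. -/
def linField (A : M3) (x : E3) : E3 := WithLp.toLp 2 (A *ᵥ x.ofLp)

/-- `u` belongs to `W^{1,2}_{C,A}`: it lies in `W^{1,2}_loc(ℝ³; ℝ³)`, with weak gradient `G`,
and `u - A x` is periodic with cell `C = [0,1]³`. -/
def MemW12CellAffine (A : M3) (u : E3 → E3) (G : E3 → M3) : Prop :=
  MemW12Loc u G ∧ IsCellPeriodic (fun x => u x - linField A x)

/-- The sequence `u j`, with weak gradients `G j`, is bounded in `W^{1,2}_loc(ℝ³; ℝ³)`. -/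
def IsBoundedW12Loc (u : ℕ → E3 → E3) (G : ℕ → E3 → M3) : Prop :=
  ∀ Q : Set E3, IsCompact Q → ∃ c : ℝ≥0, ∀ j,
    eLpNorm (u j) 2 (volume.restrict Q) ≤ c ∧
      ∀ i k : Fin 3, eLpNorm (fun x => G j x i k) 2 (volume.restrict Q) ≤ c

/-- The sequence `G j` is `L²_loc`-equi-integrable (equivalently, all its entries are). -/
def IsEquiIntegrableL2Loc (G : ℕ → E3 → M3) : Prop :=
  ∀ Q : Set E3, IsCompact Q → ∀ i k : Fin 3,
    UnifIntegrable (fun j x => G j x i k) 2 (volume.restrict Q)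

/-- `dist (G j, Z) → 0` locally in measure. -/
def DistTendstoZeroLocInMeasure (G : ℕ → E3 → M3) (Z : Set M3) : Prop :=
  ∀ Q : Set E3, IsCompact Q →
    TendstoInMeasure (volume.restrict Q) (fun j x => Metric.infDist (G j x) Z) atTop
      (fun _ => 0)

/-- The set `K^app(S)` of symmetric matrices `A` for which the differential inclusion
`∇u ∈ K(S)` has approximate solutions in `W^{1,2}_{C,A}`. -/
def KApp (S : M3) : Set M3 :=
  {A | A.IsSymm ∧ ∃ (u : ℕ → E3 → E3) (G : ℕ → E3 → M3),
    (∀ j, MemW12CellAffine A (u j) (G j)) ∧ IsBoundedW12Loc u G ∧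
      IsEquiIntegrableL2Loc G ∧ DistTendstoZeroLocInMeasure G (KSet S)}

/-- `K^*(S)` for `S = diag(s 0, s 1, s 2)` with `s 0 < s 1 < s 2`. -/
def KStarSet (s : Fin 3 → ℝ) : Set M3 :=
  {A | A ∈ KApp (Matrix.diagonal s) ∧ ∃ a : Fin 3 → ℝ, A = Matrix.diagonal a ∧
    (∀ i, a i ∈ Set.Icc (s 0) (s 2)) ∧ ∑ i, a i = 1}

/-! ### The set `𝒯²(S)`

The numbers `s₁, s₂, s₃` and `t₁, t₂, t₃` are `s 0, s 1, s 2` and `t 0, t 1, t 2`. -/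

/-- The numbers `α₋(T, S)`, `α₊(T, S)`, `β₋(T, S)`, `β₊(T, S)`. -/
noncomputable def alphaMinus (s t : Fin 3 → ℝ) : ℝ := max (t 0 / s 1) (t 1 / s 2)

noncomputable def alphaPlus (s t : Fin 3 → ℝ) : ℝ := min (t 1 / s 1) (t 2 / s 2)

noncomputable def betaMinus (s t : Fin 3 → ℝ) : ℝ := max (t 0 / s 0) (t 1 / s 1)

noncomputable def betaPlus (s t : Fin 3 → ℝ) : ℝ := min (t 1 / s 0) (t 2 / s 1)

/-- `F(x,y) = (s₁ s₃ / s₂) · x y / (x² + x y + y² - s₂ (x + y))`. -/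
noncomputable def FF (s : Fin 3 → ℝ) (x y : ℝ) : ℝ :=
  s 0 * s 2 / s 1 * (x * y / (x ^ 2 + x * y + y ^ 2 - s 1 * (x + y)))

/-- The first alternative in the definition of `𝒯²(S)`. -/
def CondAlpha (s t : Fin 3 → ℝ) : Prop :=
  alphaMinus s t = t 0 / s 1 ∧ alphaPlus s t = t 1 / s 1 ∧ t 2 = FF s (t 0) (t 1)

/-- The second alternative in the definition of `𝒯²(S)`. -/
def CondBeta (s t : Fin 3 → ℝ) : Prop :=
  betaMinus s t = t 1 / s 1 ∧ betaPlus s t = t 2 / s 1 ∧ t 0 = FF s (t 2) (t 1)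

/-- `T` is a diagonal matrix whose eigenvalues, listed in increasing order, are
`t 0 ≤ t 1 ≤ t 2` (the diagonal of `T` may list them in any order). -/
def IsDiagonalWithEigenvalues (T : M3) (t : Fin 3 → ℝ) : Prop :=
  (∃ σ : Equiv.Perm (Fin 3), T = Matrix.diagonal (t ∘ σ)) ∧ t 0 ≤ t 1 ∧ t 1 ≤ t 2

/-- The set `𝒯²(S)` of unit-trace matrices. -/
def T2 (s : Fin 3 → ℝ) : Set M3 :=
  {T | ∃ t : Fin 3 → ℝ, IsDiagonalWithEigenvalues T t ∧ s 0 ≤ t 0 ∧ t 2 ≤ s 2 ∧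
    ∑ i, t i = 1 ∧ (CondAlpha s t ∨ CondBeta s t)}

/-- The choice of `(λ₁, λ₂)`: `(t₁/s₂, t₂/s₂)` under the first alternative,
`(t₃/s₂, t₂/s₂)` under the second. -/
def IsLambdaPair (s t : Fin 3 → ℝ) (l₁ l₂ : ℝ) : Prop :=
  (CondAlpha s t ∧ l₁ = t 0 / s 1 ∧ l₂ = t 1 / s 1) ∨
    (CondBeta s t ∧ l₁ = t 2 / s 1 ∧ l₂ = t 1 / s 1)

/-- Rotations `R₁, R₂` and a unit vector `n` with `R₁ᵗ T R₁ = λ₁ S + (1 - λ₁) n ⊗ n` and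
`R₂ᵗ T R₂ = λ₂ S + (1 - λ₂) n ⊗ n`. -/
def IsRankOneConnection (S T : M3) (l₁ l₂ : ℝ) (R₁ R₂ : M3) (n : E3) : Prop :=
  R₁ ∈ SO3 ∧ R₂ ∈ SO3 ∧ ‖n‖ = 1 ∧
    R₁ᵀ * T * R₁ = l₁ • S + (1 - l₁) • tensorSq n ∧
    R₂ᵀ * T * R₂ = l₂ • S + (1 - l₂) • tensorSq n

/-!
The proof reduces approximate solvability of `∇u ∈ K(S)` to a relaxation estimate for the cubic
energy density `W_e(M) = e |M|³ + dist(M, K(S))³`. This density is continuous, invariant under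
conjugation with rotations, and positively `3`-homogeneous because `K(S)` is a cone.

Relaxation. `IsEnergyBound W A q` says that some smooth, compactly supported perturbation `φ` brings
the average of `W(A + ∇φ)` down to `q` on its domain. By Vitali's covering theorem the domain
is irrelevant (`IsEnergyBound.fill`), so these bounds are invariant under conjugation with rotations
(`IsEnergyBound.conj`) and combine convexly along segments in the direction `n ⊗ n`
(`IsEnergyBound.laminate`): this is the rank-one convexity of the relaxed energy. If `A` has energy
of order `e` for all small `e`, then the periodized nearly optimal fields are bounded in `W^{1,3}`,
hence `L²`-equi-integrable, and their gradients approach `K(S)` in `L³` (`mem_KApp_of_energyBound`).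

Why `T` has energy of order `e`. The two identities `(*)` say that, up to rotations, `T` lies on
the rank-one segment between `λ₂ S` and `(λ₂ / λ₁) T`: it is the laminate with fractions `θ` and
`k = 1 - θ = λ₁ (1 - λ₂) / (λ₂ (1 - λ₁))`. By homogeneity the infimum `q` of the energy at `T`
satisfies `q ≤ θ λ₂³ W_e(S) + k (λ₂ / λ₁)³ q`. The determinant is affine along rank-one lines, so
`det T` satisfies the same relation with equality and with `det S` instead of `W_e(S)`; therefore
`k (λ₂ / λ₁)³ < 1` and `q ≤ W_e(S) det T / det S = e |S|³ det T / det S`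
(`energyBound_of_rankOneConnection`). No infinite-rank lamination has to be constructed explicitly.

The vector `n` is found orthogonal to the middle eigenvector of `S`; then `λ₁ s₂` and `λ₂ s₂` are
eigenvalues of the two right-hand sides, and the formula `t₃ = F(t₁, t₂)` (or `t₁ = F(t₃, t₂)`) is
exactly the condition that the remaining eigenvalues agree
(`IsAdmissible.exists_rankOneConnection`). When `λ₁ = λ₂` the laminate degenerates (`θ = 0`). Such
`T` is a limit of nondegenerate matrices (`IsAdmissible.exists_near_ne`), and since the constants
above depend only on `S`, the estimate survives in the limit (`IsAdmissible.energyBound`).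

Finally the matrices in the segment `[λ₁ S, R₁ᵗ T R₁]` are laminates of the endpoints, so they too
have energy of order `e`; the bounds on their eigenvalues follow from those of the endpoints because
both the quadratic form and the trace are affine along the segment.
-/

open scoped Pointwise

/-! ### Jacobian matrices and energy bounds -/

/-- The Jacobian matrix of `φ` at `x`. -/
noncomputable def gradM (φ : E3 → E3) (x : E3) : M3 :=
  (Matrix.toEuclideanCLM (n := Fin 3) (𝕜 := ℝ)).symm (fderiv ℝ φ x)

theorem gradM_apply (φ : E3 → E3) (x : E3) (i k : Fin 3) :
    gradM φ x i k = fderiv ℝ φ x (EuclideanSpace.single k 1) i := by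
  have h : fderiv ℝ φ x = Matrix.toEuclideanCLM (n := Fin 3) (𝕜 := ℝ) (gradM φ x) := by
    simp [gradM]
  rw [h, Matrix.ofLp_toEuclideanCLM]
  simp

theorem continuous_gradM {φ : E3 → E3} (h : ContDiff ℝ ∞ φ) : Continuous (gradM φ) := by
  have h1 : Continuous (fderiv ℝ φ) := h.continuous_fderiv (by simp)
  let f : (E3 →L[ℝ] E3) →ₗ[ℝ] M3 :=
    { toFun := fun D => (Matrix.toEuclideanCLM (n := Fin 3) (𝕜 := ℝ)).symm D
      map_add' := fun _ _ => map_add _ _ _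
      map_smul' := fun _ _ => map_smul _ _ _ }
  exact (LinearMap.continuous_of_finiteDimensional f).comp h1

theorem gradM_sum {ι : Type*} (F : Finset ι) (φ : ι → E3 → E3)
    (h : ∀ i ∈ F, ContDiff ℝ ∞ (φ i)) (x : E3) :
    gradM (fun y => ∑ i ∈ F, φ i y) x = ∑ i ∈ F, gradM (φ i) x := by
  unfold gradM
  rw [fderiv_fun_sum fun i hi => ((h i hi).differentiable (by simp)) x, map_sum]

theorem gradM_add {φ ψ : E3 → E3} (hφ : ContDiff ℝ ∞ φ) (hψ : ContDiff ℝ ∞ ψ) (x : E3) :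
    gradM (fun y => φ y + ψ y) x = gradM φ x + gradM ψ x := by
  unfold gradM
  rw [fderiv_fun_add ((hφ.differentiable (by simp)) x) ((hψ.differentiable (by simp)) x), map_add]

theorem gradM_const_smul {φ : E3 → E3} (c : ℝ) (hφ : ContDiff ℝ ∞ φ) (x : E3) :
    gradM (fun y => c • φ y) x = c • gradM φ x := by
  unfold gradM
  rw [fderiv_fun_const_smul ((hφ.differentiable (by simp)) x), map_smul]

theorem gradM_eq_zero {φ : E3 → E3} {x : E3} (hx : x ∉ tsupport φ) : gradM φ x = 0 := by
  unfold gradM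
  rw [fderiv_of_notMem_tsupport (𝕜 := ℝ) hx, map_zero]

theorem gradM_linField (A : M3) (x : E3) : gradM (linField A) x = A := by
  have : linField A = Matrix.toEuclideanCLM (n := Fin 3) (𝕜 := ℝ) A := by
    ext y i; simp [linField, Matrix.ofLp_toEuclideanCLM]
  unfold gradM
  rw [this, ContinuousLinearMap.fderiv]
  simp

theorem contDiff_linField (A : M3) : ContDiff ℝ ∞ (linField A) := by
  have : linField A = Matrix.toEuclideanCLM (n := Fin 3) (𝕜 := ℝ) A := by
    ext y i; simp [linField, Matrix.ofLp_toEuclideanCLM]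
  rw [this]; exact ContinuousLinearMap.contDiff _

theorem gradM_comp_linField {φ : E3 → E3} (h : ContDiff ℝ ∞ φ) (N L : M3) (x : E3) :
    gradM (fun y => linField N (φ (linField L y))) x = N * gradM φ (linField L x) * L := by
  have e : ∀ A : M3, linField A = Matrix.toEuclideanCLM (n := Fin 3) (𝕜 := ℝ) A := by
    intro A; ext y i; simp [linField, Matrix.ofLp_toEuclideanCLM]
  have h1 : fderiv ℝ (fun y => linField N (φ (linField L y))) x =
      (Matrix.toEuclideanCLM (n := Fin 3) (𝕜 := ℝ) N) * fderiv ℝ φ (linField L x) *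
        (Matrix.toEuclideanCLM (n := Fin 3) (𝕜 := ℝ) L) := by
    have hφ := ((h.differentiable (by simp)) (linField L x)).hasFDerivAt
    rw [e] at hφ
    have h2 := hφ.comp x (Matrix.toEuclideanCLM (n := Fin 3) (𝕜 := ℝ) L).hasFDerivAt
    have h3 := (Matrix.toEuclideanCLM (n := Fin 3) (𝕜 := ℝ) N).hasFDerivAt.comp x h2
    simp only [e]
    exact h3.fderiv
  unfold gradM
  rw [h1, map_mul, map_mul]
  simp

/-- The blow-down of `φ` to a set of size `r` at `a`; it has the same gradients. -/
noncomputable def rescale (φ : E3 → E3) (a : E3) (r : ℝ) (x : E3) : E3 := r • φ (r⁻¹ • (x - a))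

theorem contDiff_rescale {φ : E3 → E3} (h : ContDiff ℝ ∞ φ) (a : E3) (r : ℝ) :
    ContDiff ℝ ∞ (rescale φ a r) := by
  unfold rescale
  exact (h.comp ((contDiff_id.sub contDiff_const).const_smul r⁻¹)).const_smul r

theorem gradM_rescale {φ : E3 → E3} (h : ContDiff ℝ ∞ φ) (a : E3) {r : ℝ} (hr : r ≠ 0) (x : E3) :
    gradM (rescale φ a r) x = gradM φ (r⁻¹ • (x - a)) := by
  unfold gradM
  congr 1
  have h1 : HasFDerivAt (fun x : E3 => r⁻¹ • (x - a)) (r⁻¹ • ContinuousLinearMap.id ℝ E3) x :=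
    ((hasFDerivAt_id x).sub_const a).const_smul r⁻¹
  have hφ := ((h.differentiable (by simp)) (r⁻¹ • (x - a))).hasFDerivAt
  have h3 := (hφ.comp x h1).const_smul r
  have h4 : fderiv ℝ (rescale φ a r) x = _ := h3.fderiv
  rw [h4]
  ext v i
  simp [hr]

/-- `q` bounds the average of `W(A + ∇φ)` over some compact set with nonempty interior
supporting the smooth perturbation `φ`. -/
def IsEnergyBound (W : M3 → ℝ) (A : M3) (q : ℝ) : Prop :=
  ∃ (B : Set E3) (φ : E3 → E3), IsCompact B ∧ (interior B).Nonempty ∧ ContDiff ℝ ∞ φ ∧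
    tsupport φ ⊆ B ∧ ∫ x in B, W (A + gradM φ x) ≤ q * volume.real B

theorem continuous_energy {W : M3 → ℝ} (hW : Continuous W) (A : M3) {φ : E3 → E3}
    (h : ContDiff ℝ ∞ φ) : Continuous (fun x => W (A + gradM φ x)) :=
  hW.comp (continuous_const.add (continuous_gradM h))

theorem integrableOn_energy {W : M3 → ℝ} (hW : Continuous W) (A : M3) {φ : E3 → E3}
    (h : ContDiff ℝ ∞ φ) {U : Set E3} (hU : Bornology.IsBounded U) :
    IntegrableOn (fun x => W (A + gradM φ x)) U :=
  ((continuous_energy hW A h).continuousOn.integrableOn_compact hU.isCompact_closure).mono_set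
    subset_closure

theorem volume_real_pos {B : Set E3} (hB : IsCompact B) (hi : (interior B).Nonempty) :
    0 < volume.real B :=
  ENNReal.toReal_pos (Measure.measure_pos_of_nonempty_interior _ hi).ne' hB.measure_lt_top.ne

/-- The map `x ↦ a + r x`: the dilation by `r` about the origin, followed by the translation by `a`. -/
def homothetyMap (a : E3) (r : ℝ) (x : E3) : E3 := a + r • x

theorem volume_real_homothety (B : Set E3) (a : E3) {r : ℝ} (hr : 0 < r) :
    volume.real (homothetyMap a r '' B) = r ^ 3 * volume.real B := by
  have : homothetyMap a r '' B = a +ᵥ r • B := by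
    ext x; simp [homothetyMap, Set.mem_vadd_set, Set.mem_smul_set]
  rw [this, measureReal_def, measure_vadd, Measure.addHaar_smul, measureReal_def,
    ENNReal.toReal_mul]
  simp [abs_of_pos hr, (pow_pos hr 3).le]

theorem setIntegral_homothety (f : E3 → ℝ) {B : Set E3} (hB : MeasurableSet B) (a : E3) {r : ℝ}
    (hr : 0 < r) :
    ∫ x in homothetyMap a r '' B, f (r⁻¹ • (x - a)) = r ^ 3 * ∫ x in B, f x := by
  have hd : ∀ x ∈ B, HasFDerivWithinAt (homothetyMap a r) (r • ContinuousLinearMap.id ℝ E3) B x := by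
    intro x _
    exact (((hasFDerivAt_id x).const_smul r).const_add a).hasFDerivWithinAt
  have hinj : Set.InjOn (homothetyMap a r) B := by
    intro x _ y _ h
    simpa [homothetyMap, hr.ne'] using h
  rw [integral_image_eq_integral_abs_det_fderiv_smul volume hB hd hinj]
  have hdet : (r • ContinuousLinearMap.id ℝ E3).det = r ^ 3 := by
    simp [ContinuousLinearMap.det]
  simp only [hdet, homothetyMap, add_sub_cancel_left, smul_smul, inv_mul_cancel₀ hr.ne', one_smul,
    abs_of_pos (pow_pos hr 3), smul_eq_mul]
  rw [integral_const_mul]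

/-! ### Filling open sets, and invariance of energy bounds -/

theorem isCompact_homothety {B : Set E3} (hB : IsCompact B) (a : E3) (r : ℝ) :
    IsCompact (homothetyMap a r '' B) :=
  hB.image (by unfold homothetyMap; fun_prop)

theorem interior_homothety_nonempty {B : Set E3} (hB : (interior B).Nonempty) (a : E3) {r : ℝ}
    (hr : r ≠ 0) : (interior (homothetyMap a r '' B)).Nonempty := by
  have e : ∀ O : Set E3, homothetyMap a r '' O = a +ᵥ r • O := by
    intro O; ext x; simp [homothetyMap, Set.mem_vadd_set, Set.mem_smul_set]
  have ho : IsOpen (homothetyMap a r '' interior B) := by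
    rw [e]; exact (isOpen_interior.smul₀ hr).vadd a
  exact (hB.image _).mono (interior_maximal (Set.image_mono interior_subset) ho)

theorem tsupport_rescale_subset {B : Set E3} (hB : IsCompact B) {φ : E3 → E3}
    (hφ : tsupport φ ⊆ B) (a : E3) {r : ℝ} (hr : r ≠ 0) :
    tsupport (rescale φ a r) ⊆ homothetyMap a r '' B := by
  refine closure_minimal ?_ (isCompact_homothety hB a r).isClosed
  intro x hx
  refine ⟨r⁻¹ • (x - a), hφ (subset_tsupport φ ?_), ?_⟩
  · intro h
    exact hx (by simp [rescale, h])
  · simp [homothetyMap, smul_smul, hr]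

/-- Vitali's covering theorem, for homothetic copies of a fixed compact set `B` with ratios
at most `ε`: finitely many disjoint copies exhaust an open set up to measure `δ`. -/
theorem exists_disjoint_homothetic_copies {B : Set E3} (hB : IsCompact B)
    (hi : (interior B).Nonempty) {U : Set E3} (hU : IsOpen U) (hb : Bornology.IsBounded U)
    {ε δ : ℝ} (hε : 0 < ε) (hδ : 0 < δ) :
    ∃ F : Finset (E3 × ℝ), (∀ p ∈ F, 0 < p.2 ∧ p.2 ≤ ε ∧ homothetyMap p.1 p.2 '' B ⊆ U) ∧
      (F : Set (E3 × ℝ)).PairwiseDisjoint (fun p => homothetyMap p.1 p.2 '' B) ∧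
      volume.real (U \ ⋃ p ∈ F, homothetyMap p.1 p.2 '' B) ≤ δ := by
  obtain ⟨ρ, hρ, hBρ⟩ := hB.isBounded.subset_closedBall_lt 0 0
  have hBpos := volume_real_pos hB hi
  have hUfin : volume U ≠ ⊤ := hb.measure_lt_top.ne
  set t : Set (E3 × ℝ) := {p | 0 < p.2 ∧ p.2 ≤ ε ∧ homothetyMap p.1 p.2 '' B ⊆ U} with ht
  have hsub : ∀ p : E3 × ℝ, 0 < p.2 →
      homothetyMap p.1 p.2 '' B ⊆ Metric.closedBall p.1 (ρ * p.2) := by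
    rintro p hp _ ⟨y, hy, rfl⟩
    have := hBρ hy
    rw [mem_closedBall_zero_iff] at this
    rw [mem_closedBall_iff_norm]
    simp only [homothetyMap, add_sub_cancel_left, norm_smul, Real.norm_eq_abs, abs_of_pos hp]
    nlinarith
  set C : ℝ≥0 := (volume.real (Metric.closedBall (0 : E3) (3 * ρ)) / volume.real B).toNNReal
    with hC
  obtain ⟨u, hut, huc, hud, hu0⟩ := Vitali.exists_disjoint_covering_ae volume U t C
    (fun p => ρ * p.2) (fun p => p.1) (fun p => homothetyMap p.1 p.2 '' B)
    (fun p hp => hsub p hp.1) (by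
      intro p hp
      have e : Metric.closedBall p.1 (3 * (ρ * p.2)) ⊆
          homothetyMap p.1 p.2 '' Metric.closedBall (0 : E3) (3 * ρ) := by
        intro x hx
        rw [mem_closedBall_iff_norm] at hx
        refine ⟨p.2⁻¹ • (x - p.1), ?_, by simp [homothetyMap, smul_smul, hp.1.ne']⟩
        rw [mem_closedBall_zero_iff, norm_smul, norm_inv, Real.norm_eq_abs, abs_of_pos hp.1,
          inv_mul_le_iff₀ hp.1]
        linarith
      have h1 := measureReal_mono (μ := volume) e
        (isCompact_homothety (isCompact_closedBall _ _) _ _).measure_lt_top.ne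
      rw [volume_real_homothety _ _ hp.1] at h1
      have h2 := volume_real_homothety B p.1 hp.1
      have h3 : volume.real (Metric.closedBall p.1 (3 * (ρ * p.2))) ≤
          C * volume.real (homothetyMap p.1 p.2 '' B) := by
        rw [h2, hC, Real.coe_toNNReal _ (by positivity)]
        refine h1.trans (le_of_eq ?_)
        field_simp
      have hf := (isCompact_homothety hB p.1 p.2).measure_lt_top (μ := volume).ne
      have hf2 : volume (Metric.closedBall p.1 (3 * (ρ * p.2))) ≠ ⊤ :=
        measure_closedBall_lt_top.ne
      rw [measureReal_def, measureReal_def] at h3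
      rw [← ENNReal.ofReal_toReal hf2, ← ENNReal.ofReal_toReal hf, ← ENNReal.ofReal_coe_nnreal,
        ← ENNReal.ofReal_mul C.coe_nonneg]
      exact ENNReal.ofReal_le_ofReal h3)
    (fun p hp => interior_homothety_nonempty hi _ hp.1.ne')
    (fun p _ => (isCompact_homothety hB _ _).isClosed) (by
      intro x hx η hη
      obtain ⟨κ, hκ, hball⟩ := Metric.isOpen_iff.1 hU x hx
      set r := min (η / ρ) (min ε (κ / (2 * ρ))) with hr
      have hr0 : 0 < r := by positivity
      have h1 : ρ * r ≤ η := by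
        have := min_le_left (η / ρ) (min ε (κ / (2 * ρ)))
        rw [← hr, le_div_iff₀ hρ] at this
        linarith
      have h2 : r ≤ ε := (min_le_right _ _).trans (min_le_left _ _)
      have h3 : ρ * r < κ := by
        have := (min_le_right (η / ρ) (min ε (κ / (2 * ρ)))).trans (min_le_right _ _)
        rw [← hr, le_div_iff₀ (by positivity)] at this
        linarith
      refine ⟨(x, r), ⟨hr0, h2, ?_⟩, h1, rfl⟩
      exact ((hsub (x, r) hr0).trans (Metric.closedBall_subset_ball h3)).trans hball)
  have hmeas : ∀ p : E3 × ℝ, MeasurableSet (homothetyMap p.1 p.2 '' B) :=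
    fun p => (isCompact_homothety hB _ _).measurableSet
  have hUu : volume U = ∑' p : u, volume (homothetyMap p.1.1 p.1.2 '' B) := by
    rw [← measure_biUnion huc hud fun p _ => hmeas p]
    refine le_antisymm (measure_mono_ae ?_) (measure_mono (Set.iUnion₂_subset fun p hp => (hut hp).2.2))
    exact ae_le_set.2 hu0
  have hsum : HasSum (fun p : u => volume.real (homothetyMap p.1.1 p.1.2 '' B))
      (volume.real U) := by
    have h1 : ∑' p : u, volume (homothetyMap p.1.1 p.1.2 '' B) ≠ ⊤ := hUu ▸ hUfin
    have h2 := ENNReal.hasSum_toReal h1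
    rwa [← ENNReal.tsum_toReal_eq (fun p => (isCompact_homothety hB _ _).measure_lt_top.ne),
      ← hUu] at h2
  obtain ⟨F, hF⟩ := ((hsum.eventually (lt_mem_nhds (sub_lt_self (volume.real U) hδ)))).exists
  classical
  refine ⟨F.map (Function.Embedding.subtype _), ?_, ?_, ?_⟩
  · intro p hp
    obtain ⟨q, -, rfl⟩ := Finset.mem_map.1 hp
    exact hut q.2
  · refine hud.subset ?_
    intro p hp
    obtain ⟨q, -, rfl⟩ := Finset.mem_map.1 (Finset.mem_coe.1 hp)
    exact q.2
  · have hFd : (F.map (Function.Embedding.subtype _) : Set (E3 × ℝ)).PairwiseDisjoint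
        (fun p => homothetyMap p.1 p.2 '' B) := by
      refine hud.subset ?_
      intro p hp
      obtain ⟨q, -, rfl⟩ := Finset.mem_map.1 (Finset.mem_coe.1 hp)
      exact q.2
    have hsubU : (⋃ p ∈ F.map (Function.Embedding.subtype _), homothetyMap p.1 p.2 '' B) ⊆ U := by
      refine Set.iUnion₂_subset fun p hp => ?_
      obtain ⟨q, -, rfl⟩ := Finset.mem_map.1 hp
      exact (hut q.2).2.2
    have hm : MeasurableSet
        (⋃ p ∈ F.map (Function.Embedding.subtype _), homothetyMap p.1 p.2 '' B) :=
      Finset.measurableSet_biUnion _ fun p _ => hmeas p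
    rw [measureReal_sdiff hsubU hm hUfin, measureReal_biUnion_finset hFd (fun p _ => hmeas p)
      (fun p _ => (isCompact_homothety hB _ _).measure_lt_top.ne), Finset.sum_map]
    simp only [Function.Embedding.subtype_apply]
    linarith

theorem IsEnergyBound.nonneg {W : M3 → ℝ} (hW0 : ∀ M, 0 ≤ W M) {A : M3} {q : ℝ}
    (h : IsEnergyBound W A q) : 0 ≤ q := by
  obtain ⟨B, φ, hB, hi, -, -, hq⟩ := h
  have h0 : 0 ≤ ∫ x in B, W (A + gradM φ x) := integral_nonneg fun x => hW0 _
  exact nonneg_of_mul_nonneg_left (h0.trans hq) (volume_real_pos hB hi)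

/-- An energy bound on one domain transfers to every bounded open set, up to `δ`, with a uniformly
small perturbation: fill the set with disjoint small homothetic copies of the domain. -/
theorem IsEnergyBound.fill {W : M3 → ℝ} (hW : Continuous W) (hW0 : ∀ M, 0 ≤ W M) {A : M3} {q : ℝ}
    (h : IsEnergyBound W A q) {U : Set E3} (hU : IsOpen U) (hb : Bornology.IsBounded U)
    {δ : ℝ} (hδ : 0 < δ) :
    ∃ φ : E3 → E3, ContDiff ℝ ∞ φ ∧ tsupport φ ⊆ U ∧ (∀ x, ‖φ x‖ ≤ δ) ∧
      ∫ x in U, W (A + gradM φ x) ≤ q * volume.real U + δ := by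
  classical
  have hq0 := h.nonneg hW0
  obtain ⟨B, φ₀, hB, hi, hφ, hs, hq⟩ := h
  obtain ⟨M, hM⟩ := hφ.continuous.bounded_above_of_compact_support
    (HasCompactSupport.of_support_subset_isCompact hB ((subset_tsupport _).trans hs))
  have hM0 : 0 ≤ M := (norm_nonneg _).trans (hM 0)
  have hUfin : volume U ≠ ⊤ := hb.measure_lt_top.ne
  obtain ⟨F, hF, hFd, hFv⟩ := exists_disjoint_homothetic_copies hB hi hU hb
    (ε := δ / (M + 1)) (δ := δ / (W A + 1)) (by positivity)
    (div_pos hδ (by linarith [hW0 A]))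
  set b : E3 × ℝ → Set E3 := fun p => homothetyMap p.1 p.2 '' B with hbdef
  have hbc : ∀ p, IsCompact (b p) := fun p => isCompact_homothety hB _ _
  set φ : E3 → E3 := fun x => ∑ p ∈ F, rescale φ₀ p.1 p.2 x with hφdef
  have hts : ∀ p ∈ F, tsupport (rescale φ₀ p.1 p.2) ⊆ b p :=
    fun p hp => tsupport_rescale_subset hB hs p.1 (hF p hp).1.ne'
  have hφsm : ContDiff ℝ ∞ φ := ContDiff.sum fun p _ => contDiff_rescale hφ _ _
  have hgrad : ∀ x, gradM φ x = ∑ p ∈ F, gradM (rescale φ₀ p.1 p.2) x :=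
    gradM_sum F _ fun p _ => contDiff_rescale hφ _ _
  have hout : ∀ p ∈ F, ∀ x ∈ b p, ∀ p' ∈ F, p' ≠ p → x ∉ tsupport (rescale φ₀ p'.1 p'.2) := by
    intro p hp x hx p' hp' hne hx'
    exact Set.disjoint_left.1 (hFd hp' hp hne) (hts p' hp' hx') hx
  have hvals : ∀ x, x ∉ ⋃ p ∈ F, b p → φ x = 0 := by
    intro x hx
    refine Finset.sum_eq_zero fun p hp => ?_
    refine image_eq_zero_of_notMem_tsupport fun h => hx ?_
    exact Set.mem_biUnion (Finset.mem_coe.2 hp) (hts p hp h)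
  refine ⟨φ, hφsm, ?_, ?_, ?_⟩
  · have hcl : IsClosed (⋃ p ∈ F, b p) := F.finite_toSet.isClosed_biUnion fun p _ => (hbc p).isClosed
    refine (closure_minimal ?_ hcl).trans (Set.iUnion₂_subset fun p hp => (hF p hp).2.2)
    intro x hx
    by_contra hcon
    exact hx (hvals x hcon)
  · intro x
    by_cases hx : x ∈ ⋃ p ∈ F, b p
    · simp only [Set.mem_iUnion, exists_prop] at hx
      obtain ⟨p, hp, hxp⟩ := hx
      have : φ x = rescale φ₀ p.1 p.2 x :=
        Finset.sum_eq_single_of_mem p hp fun p' hp' hne =>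
          image_eq_zero_of_notMem_tsupport (hout p hp x hxp p' hp' hne)
      rw [this, rescale, norm_smul, Real.norm_eq_abs, abs_of_pos (hF p hp).1]
      have h1 := (hF p hp).2.1
      rw [le_div_iff₀ (by positivity)] at h1
      have h2 := hM (p.2⁻¹ • (x - p.1))
      nlinarith [(hF p hp).1, mul_le_mul_of_nonneg_left h2 (hF p hp).1.le]
    · rw [hvals x hx, norm_zero]; exact hδ.le
  · have hint : IntegrableOn (fun x => W (A + gradM φ x)) U := integrableOn_energy hW A hφsm hb
    have hsub : (⋃ p ∈ F, b p) ⊆ U := Set.iUnion₂_subset fun p hp => (hF p hp).2.2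
    have hm : MeasurableSet (⋃ p ∈ F, b p) :=
      Finset.measurableSet_biUnion _ fun p _ => (hbc p).measurableSet
    rw [← Set.union_sdiff_cancel hsub, setIntegral_union Set.disjoint_sdiff_right
      (hU.measurableSet.diff hm) (hint.mono_set hsub) (hint.mono_set Set.sdiff_subset),
      Set.union_sdiff_cancel hsub,
      integral_biUnion_finset F (fun p _ => (hbc p).measurableSet) hFd
        (fun p hp => hint.mono_set (hF p hp).2.2)]
    have h1 : ∀ p ∈ F, ∫ x in b p, W (A + gradM φ x) ≤ q * volume.real (b p) := by
      intro p hp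
      have hp0 := (hF p hp).1
      have e : ∫ x in b p, W (A + gradM φ x) =
          ∫ x in b p, W (A + gradM φ₀ (p.2⁻¹ • (x - p.1))) := by
        refine setIntegral_congr_fun (hbc p).measurableSet fun x hx => ?_
        have : gradM φ x = gradM (rescale φ₀ p.1 p.2) x := by
          rw [hgrad]
          exact Finset.sum_eq_single_of_mem p hp fun p' hp' hne =>
            gradM_eq_zero (hout p hp x hx p' hp' hne)
        simp only [this, gradM_rescale hφ p.1 hp0.ne']
      rw [e, setIntegral_homothety (fun y => W (A + gradM φ₀ y)) hB.measurableSet p.1 hp0,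
        volume_real_homothety B p.1 hp0]
      nlinarith [pow_pos hp0 3]
    have h2 : ∫ x in U \ ⋃ p ∈ F, b p, W (A + gradM φ x) =
        W A * volume.real (U \ ⋃ p ∈ F, b p) := by
      have e : ∫ x in U \ ⋃ p ∈ F, b p, W (A + gradM φ x) = ∫ x in U \ ⋃ p ∈ F, b p, W A := by
        refine setIntegral_congr_fun (hU.measurableSet.diff hm) fun x hx => ?_
        have : gradM φ x = 0 := by
          rw [hgrad]
          refine Finset.sum_eq_zero fun p hp => gradM_eq_zero fun h => hx.2 ?_
          exact Set.mem_biUnion (Finset.mem_coe.2 hp) (hts p hp h)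
        simp [this]
      rw [e, setIntegral_const, smul_eq_mul, mul_comm]
    have h3 : ∑ p ∈ F, volume.real (b p) ≤ volume.real U := by
      rw [← measureReal_biUnion_finset hFd (fun p _ => (hbc p).measurableSet)
        (fun p _ => (hbc p).measure_lt_top.ne)]
      exact measureReal_mono hsub hUfin
    have h4 : W A * volume.real (U \ ⋃ p ∈ F, b p) ≤ δ := by
      have := hFv
      rw [le_div_iff₀ (by linarith [hW0 A])] at this
      nlinarith [measureReal_nonneg (μ := volume) (s := U \ ⋃ p ∈ F, b p)]
    calc _ ≤ ∑ p ∈ F, q * volume.real (b p) + δ := by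
          rw [h2]; exact add_le_add (Finset.sum_le_sum h1) h4
      _ ≤ _ := by rw [← Finset.mul_sum]; gcongr

theorem transpose_mul_self_of_mem_SO3 {R : M3} (hR : R ∈ SO3) : Rᵀ * R = 1 := by
  simpa [Matrix.star_eq_conjTranspose] using
    (Matrix.mem_orthogonalGroup_iff' (Fin 3) ℝ).1 (Matrix.mem_specialOrthogonalGroup_iff.1 hR).1

theorem mul_transpose_self_of_mem_SO3 {R : M3} (hR : R ∈ SO3) : R * Rᵀ = 1 := by
  simpa [Matrix.star_eq_conjTranspose] using
    (Matrix.mem_orthogonalGroup_iff (Fin 3) ℝ).1 (Matrix.mem_specialOrthogonalGroup_iff.1 hR).1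

theorem transpose_mem_SO3 {R : M3} (hR : R ∈ SO3) : Rᵀ ∈ SO3 := by
  refine Matrix.mem_specialOrthogonalGroup_iff.2 ⟨?_, ?_⟩
  · rw [Matrix.mem_orthogonalGroup_iff]
    simpa [Matrix.star_eq_conjTranspose] using transpose_mul_self_of_mem_SO3 hR
  · rw [Matrix.det_transpose]; exact (Matrix.mem_specialOrthogonalGroup_iff.1 hR).2

theorem linField_linField (M N : M3) (x : E3) : linField M (linField N x) = linField (M * N) x := by
  simp [linField, Matrix.mulVec_mulVec]

theorem linField_one (x : E3) : linField (1 : M3) x = x := by simp [linField]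

/-- The rotation `x ↦ R x` as a linear isometry. -/
noncomputable def rotationIsometry {R : M3} (hR : R ∈ SO3) : E3 ≃ₗᵢ[ℝ] E3 where
  toFun := linField R
  invFun := linField Rᵀ
  left_inv x := by rw [linField_linField, transpose_mul_self_of_mem_SO3 hR, linField_one]
  right_inv x := by rw [linField_linField, mul_transpose_self_of_mem_SO3 hR, linField_one]
  map_add' x y := by simp [linField, Matrix.mulVec_add]
  map_smul' c x := by simp [linField, Matrix.mulVec_smul]
  norm_map' x := by
    have h1 : ‖linField R x‖ ^ 2 = ‖x‖ ^ 2 := by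
      rw [← real_inner_self_eq_norm_sq, ← real_inner_self_eq_norm_sq]
      simp only [EuclideanSpace.inner_eq_star_dotProduct, linField, star_trivial]
      rw [Matrix.dotProduct_mulVec, ← Matrix.mulVec_transpose, Matrix.mulVec_mulVec,
        transpose_mul_self_of_mem_SO3 hR, Matrix.one_mulVec]
    exact (pow_left_inj₀ (norm_nonneg _) (norm_nonneg _) two_ne_zero).1 h1

/-- Energy bounds are stable under conjugation with rotations. -/
theorem IsEnergyBound.conj {W : M3 → ℝ}
    (hinv : ∀ R ∈ SO3, ∀ M, W (Rᵀ * M * R) = W M) {A : M3} {q : ℝ}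
    (h : IsEnergyBound W A q) {R : M3} (hR : R ∈ SO3) : IsEnergyBound W (Rᵀ * A * R) q := by
  obtain ⟨B, φ, hB, hi, hφ, hs, hq⟩ := h
  set f := rotationIsometry hR with hf
  have hfx : ∀ x, f x = linField R x := fun x => rfl
  have hpre : f ⁻¹' B = f.symm '' B := by
    have := f.toEquiv.symm.image_eq_preimage_symm B
    exact this.symm
  refine ⟨f ⁻¹' B, fun y => linField Rᵀ (φ (linField R y)), ?_, ?_, ?_, ?_, ?_⟩
  · rw [hpre]; exact hB.image f.symm.continuous
  · obtain ⟨x, hx⟩ := hi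
    refine ⟨f.symm x, interior_maximal (Set.preimage_mono interior_subset)
      (isOpen_interior.preimage f.continuous) ?_⟩
    simpa using hx
  · exact (contDiff_linField _).comp (hφ.comp (contDiff_linField _))
  · refine closure_minimal ?_ (hB.isClosed.preimage f.continuous)
    intro y hy
    refine hs (subset_tsupport φ fun h => hy ?_)
    change linField Rᵀ (φ (linField R y)) = 0
    rw [show φ (linField R y) = 0 from h]
    simp [linField]
  · have h1 : ∀ y, W (Rᵀ * A * R + gradM (fun y => linField Rᵀ (φ (linField R y))) y) =
        W (A + gradM φ (f y)) := by
      intro y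
      rw [gradM_comp_linField hφ, ← hinv R hR (A + gradM φ (f y)), hfx, mul_add, add_mul]
    simp only [h1]
    rw [f.measurePreserving.setIntegral_preimage_emb f.toHomeomorph.measurableEmbedding
      (fun x => W (A + gradM φ x)), measureReal_def,
      f.measurePreserving.measure_preimage hB.measurableSet.nullMeasurableSet]
    exact hq

/-- Energy bounds for a positively `3`-homogeneous density are `3`-homogeneous. -/
theorem IsEnergyBound.smul {W : M3 → ℝ} {c : ℝ} (hhom : ∀ M, W (c • M) = c ^ 3 * W M)
    (hc : 0 ≤ c) {A : M3} {q : ℝ} (h : IsEnergyBound W A q) :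
    IsEnergyBound W (c • A) (c ^ 3 * q) := by
  obtain ⟨B, φ, hB, hi, hφ, hs, hq⟩ := h
  refine ⟨B, fun x => c • φ x, hB, hi, hφ.const_smul c,
    (tsupport_smul_subset_right (fun _ => c) φ).trans hs, ?_⟩
  simp only [gradM_const_smul c hφ, ← smul_add, hhom]
  rw [integral_const_mul, mul_assoc]
  exact mul_le_mul_of_nonneg_left hq (pow_nonneg hc 3)

/-- The zero perturbation gives the trivial energy bound. -/
theorem isEnergyBound_self (W : M3 → ℝ) (A : M3) : IsEnergyBound W A (W A) := by
  refine ⟨Metric.closedBall 0 1, fun _ => 0, isCompact_closedBall _ _, ?_, contDiff_const, ?_, ?_⟩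
  · exact ⟨0, Metric.ball_subset_interior_closedBall (Metric.mem_ball_self one_pos)⟩
  · simp [tsupport]
  · have : ∀ x, gradM (fun _ : E3 => (0 : E3)) x = 0 := fun x => by simp [gradM]
    simp [this, mul_comm]

theorem IsEnergyBound.mono {W : M3 → ℝ} {A : M3} {q q' : ℝ} (h : IsEnergyBound W A q)
    (hqq : q ≤ q') : IsEnergyBound W A q' := by
  obtain ⟨B, φ, hB, hi, hφ, hs, hq⟩ := h
  exact ⟨B, φ, hB, hi, hφ, hs, hq.trans (by gcongr)⟩

/-- Shifting the matrix changes energy bounds in a controlled way, for densities satisfying a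
quasi-triangle inequality. -/
theorem IsEnergyBound.shift {W : M3 → ℝ} (hW : Continuous W) {A E : M3} {a b : ℝ}
    (hE : ∀ M, W (M + E) ≤ a * W M + b) {q : ℝ} (h : IsEnergyBound W A q) (ha : 0 ≤ a) :
    IsEnergyBound W (A + E) (a * q + b) := by
  obtain ⟨B, φ, hB, hi, hφ, hs, hq⟩ := h
  refine ⟨B, φ, hB, hi, hφ, hs, ?_⟩
  have hint := integrableOn_energy hW A hφ hB.isBounded
  calc ∫ x in B, W (A + E + gradM φ x) ≤ ∫ x in B, (a * W (A + gradM φ x) + b) := by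
        refine setIntegral_mono (integrableOn_energy hW _ hφ hB.isBounded)
          ((hint.const_mul a).add (integrableOn_const hB.measure_lt_top.ne)) fun x => ?_
        rw [add_right_comm]; exact hE _
    _ = a * (∫ x in B, W (A + gradM φ x)) + b * volume.real B := by
        rw [integral_add (hint.const_mul a) (integrableOn_const hB.measure_lt_top.ne),
          integral_const_mul, setIntegral_const, smul_eq_mul, mul_comm b]
    _ ≤ _ := by nlinarith

/-! ### Lamination in a coordinate direction -/

/-- A smooth profile supported in `[0,1]` with slopes `1 - θ` and `-θ` on almost all of `(0,θ)` and
`(θ,1)` respectively. -/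
theorem exists_sawtooth_profile {θ η : ℝ} (h0 : 0 < θ) (h1 : θ < 1) (hη : 0 < η) (hη' : η < 1 / 2) :
    ∃ h : ℝ → ℝ, ContDiff ℝ ∞ h ∧ (∀ t, t ∉ Set.Icc (0 : ℝ) 1 → h t = 0) ∧ (∀ t, |h t| ≤ 1) ∧
      (∀ t, |deriv h t| ≤ 1) ∧
      (∀ t ∈ Set.Ioo (θ * η) (θ * (1 - η)), deriv h t = 1 - θ) ∧
      (∀ t ∈ Set.Ioo (θ + (1 - θ) * η) (θ + (1 - θ) * (1 - η)), deriv h t = -θ) := by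
  let b : ContDiffBump (1 / 2 : ℝ) := ⟨1 / 2 - η, 1 / 2, by linarith, by linarith⟩
  have hbc : Continuous (b : ℝ → ℝ) := b.continuous
  have hb1 : ∀ t, η < t → t < 1 - η → b t = 1 := by
    intro t ht ht'
    refine b.one_of_mem_closedBall ?_
    change t ∈ Metric.closedBall (1 / 2 : ℝ) (1 / 2 - η)
    rw [Real.closedBall_eq_Icc]
    constructor <;> linarith
  have hb0 : ∀ t, t ≤ 0 ∨ 1 ≤ t → b t = 0 := by
    intro t ht
    refine b.zero_of_le_dist ?_
    change (1 / 2 : ℝ) ≤ dist t (1 / 2)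
    rw [Real.dist_eq, le_abs]
    rcases ht with ht | ht
    · right; linarith
    · left; linarith
  let H : ℝ → ℝ := fun t => ∫ s in (0 : ℝ)..t, b s
  have hH : ∀ t, HasDerivAt H (b t) t := fun t =>
    intervalIntegral.integral_hasDerivAt_right (hbc.intervalIntegrable _ _)
      (hbc.stronglyMeasurableAtFilter _ _) hbc.continuousAt
  have hHs : ContDiff ℝ ∞ H := by
    rw [contDiff_infty_iff_deriv]
    refine ⟨fun t => (hH t).differentiableAt, ?_⟩
    rw [show deriv H = b from funext fun t => (hH t).deriv]
    exact b.contDiff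
  have hH0 : ∀ t ≤ 0, H t = 0 := by
    intro t ht
    have : H t = ∫ s in (0 : ℝ)..t, (0 : ℝ) := by
      refine intervalIntegral.integral_congr fun s hs => hb0 s (Or.inl ?_)
      rw [Set.uIcc_of_ge ht] at hs; exact hs.2
    simpa using this
  have hH1 : ∀ t, 1 ≤ t → H t = H 1 := by
    intro t ht
    have h2 : H t - H 1 = ∫ s in (1 : ℝ)..t, b s :=
      intervalIntegral.integral_interval_sub_left (hbc.intervalIntegrable _ _)
        (hbc.intervalIntegrable _ _)
    have : ∫ s in (1 : ℝ)..t, b s = ∫ s in (1 : ℝ)..t, (0 : ℝ) := by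
      refine intervalIntegral.integral_congr fun s hs => hb0 s (Or.inr ?_)
      rw [Set.uIcc_of_le ht] at hs; exact hs.1
    rw [this] at h2
    simp at h2
    linarith
  have h1' : 0 < 1 - θ := by linarith
  let h : ℝ → ℝ := fun t => (1 - θ) * θ * (H (t / θ) - H ((t - θ) / (1 - θ)))
  have hd : ∀ t, HasDerivAt h ((1 - θ) * b (t / θ) - θ * b ((t - θ) / (1 - θ))) t := by
    intro t
    have e1 := (hH (t / θ)).comp t ((hasDerivAt_id t).div_const θ)
    have e2 := (hH ((t - θ) / (1 - θ))).comp t (((hasDerivAt_id t).sub_const θ).div_const (1 - θ))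
    have e3 := (e1.sub e2).const_mul ((1 - θ) * θ)
    refine e3.congr_deriv ?_
    field_simp
  have hhs : ContDiff ℝ ∞ h :=
    contDiff_const.mul ((hHs.comp (contDiff_id.div_const θ)).sub
      (hHs.comp ((contDiff_id.sub contDiff_const).div_const (1 - θ))))
  have hzero : ∀ t, t ≤ 0 ∨ 1 ≤ t → h t = 0 := by
    intro t ht
    simp only [h]
    rcases ht with ht | ht
    · rw [hH0 _ (div_nonpos_of_nonpos_of_nonneg ht h0.le),
        hH0 _ (div_nonpos_of_nonpos_of_nonneg (by linarith) h1'.le)]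
      simp
    · rw [hH1 (t / θ) (by rw [le_div_iff₀ h0]; linarith),
        hH1 ((t - θ) / (1 - θ)) (by rw [le_div_iff₀ h1']; linarith)]
      simp
  have hder : ∀ t, |deriv h t| ≤ 1 := by
    intro t
    rw [(hd t).deriv, abs_le]
    have a1 := b.nonneg (x := t / θ)
    have a2 := b.le_one (x := t / θ)
    have a3 := b.nonneg (x := (t - θ) / (1 - θ))
    have a4 := b.le_one (x := (t - θ) / (1 - θ))
    constructor <;> nlinarith
  refine ⟨h, hhs, ?_, ?_, hder, ?_, ?_⟩
  · intro t ht
    refine hzero t ?_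
    by_contra! hc
    exact ht ⟨hc.1.le, hc.2.le⟩
  · intro t
    by_cases ht : t ≤ 0 ∨ 1 ≤ t
    · rw [hzero t ht]; simp
    · push Not at ht
      have := Convex.norm_image_sub_le_of_norm_deriv_le (f := h) (s := Set.univ) (C := 1)
        (x := 0) (y := t) (fun x _ => (hd x).differentiableAt) (fun x _ => hder x) convex_univ
        trivial trivial
      rw [hzero 0 (Or.inl le_rfl)] at this
      simp only [sub_zero, Real.norm_eq_abs, one_mul] at this
      exact this.trans (by rw [abs_of_pos ht.1]; exact ht.2.le)
  · intro t ht
    rw [(hd t).deriv, hb1 (t / θ) (by rw [lt_div_iff₀ h0]; linarith [ht.1])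
      (by rw [div_lt_iff₀ h0]; linarith [ht.2]), hb0 _ (Or.inl (div_nonpos_of_nonpos_of_nonneg
        (by nlinarith [ht.2]) h1'.le))]
    ring
  · intro t ht
    rw [(hd t).deriv, hb1 ((t - θ) / (1 - θ)) (by rw [lt_div_iff₀ h1']; linarith [ht.1])
      (by rw [div_lt_iff₀ h1']; linarith [ht.2]), hb0 (t / θ) (Or.inr (by
        rw [le_div_iff₀ h0]; nlinarith [ht.1]))]
    ring

/-- Smooth cut-offs of long intervals `[0, L]`, with slopes bounded independently of `L`. -/
theorem exists_interval_cutoff :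
    ∃ D : ℝ, 0 ≤ D ∧ ∀ L : ℝ, ∃ χ : ℝ → ℝ, ContDiff ℝ ∞ χ ∧
      (∀ t, t ∉ Set.Icc 0 L → χ t = 0) ∧ (∀ t, |χ t| ≤ 1) ∧ (∀ t, |deriv χ t| ≤ D) ∧
      (∀ t ∈ Set.Ioo 1 (L - 1), χ t = 1 ∧ deriv χ t = 0) := by
  set σ := Real.smoothTransition
  have hσ : ContDiff ℝ ∞ σ := Real.smoothTransition.contDiff
  have hdc : Continuous (deriv σ) := hσ.continuous_deriv (by simp)
  have hout : ∀ t, t ∉ Set.Icc (0 : ℝ) 1 → deriv σ t = 0 := by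
    intro t ht
    rw [Set.mem_Icc, not_and_or, not_le, not_le] at ht
    rcases ht with ht | ht
    · have : σ =ᶠ[𝓝 t] fun _ => 0 := by
        filter_upwards [gt_mem_nhds ht] with s hs
        exact Real.smoothTransition.zero_of_nonpos hs.le
      rw [this.deriv_eq]; simp
    · have : σ =ᶠ[𝓝 t] fun _ => 1 := by
        filter_upwards [lt_mem_nhds ht] with s hs
        exact Real.smoothTransition.one_of_one_le hs.le
      rw [this.deriv_eq]; simp
  obtain ⟨D, hD⟩ := (isCompact_Icc (a := (0 : ℝ)) (b := 1)).exists_bound_of_continuousOn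
    hdc.continuousOn
  have hD0 : 0 ≤ D := (norm_nonneg _).trans (hD 0 (by simp))
  have hDall : ∀ t, |deriv σ t| ≤ D := by
    intro t
    by_cases ht : t ∈ Set.Icc (0 : ℝ) 1
    · exact hD t ht
    · rw [hout t ht]; simpa using hD0
  have h01 : ∀ t, |σ t| ≤ 1 := fun t => by
    rw [abs_of_nonneg (Real.smoothTransition.nonneg t)]; exact Real.smoothTransition.le_one t
  refine ⟨2 * D, by positivity, fun L => ⟨fun t => σ t * σ (L - t), ?_, ?_, ?_, ?_, ?_⟩⟩
  · exact hσ.mul (hσ.comp (contDiff_const.sub contDiff_id))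
  · intro t ht
    rw [Set.mem_Icc, not_and_or, not_le, not_le] at ht
    rcases ht with ht | ht
    · simp [σ, Real.smoothTransition.zero_of_nonpos ht.le]
    · simp [σ, Real.smoothTransition.zero_of_nonpos (show L - t ≤ 0 by linarith)]
  · intro t
    rw [abs_mul]
    exact mul_le_one₀ (h01 _) (abs_nonneg _) (h01 _)
  · intro t
    have hd : ∀ s, HasDerivAt σ (deriv σ s) s := fun s => ((hσ.differentiable (by simp)) s).hasDerivAt
    have := (hd t).mul ((hd (L - t)).comp t ((hasDerivAt_id t).const_sub L))
    have e : deriv (fun t => σ t * σ (L - t)) t =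
        deriv σ t * σ (L - t) + σ t * (deriv σ (L - t) * -1) := this.deriv
    rw [e]
    refine (abs_add_le _ _).trans ?_
    simp only [abs_mul, abs_neg, abs_one, mul_one]
    nlinarith [hDall t, hDall (L - t), h01 t, h01 (L - t), abs_nonneg (σ t), abs_nonneg (σ (L - t)),
      abs_nonneg (deriv σ t), abs_nonneg (deriv σ (L - t))]
  · intro t ht
    have : (fun t => σ t * σ (L - t)) =ᶠ[𝓝 t] fun _ => 1 := by
      filter_upwards [isOpen_Ioo.mem_nhds ht] with s hs
      simp [σ, Real.smoothTransition.one_of_one_le hs.1.le,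
        Real.smoothTransition.one_of_one_le (show 1 ≤ L - s by linarith [hs.2])]
    exact ⟨this.self_of_nhds, by rw [this.deriv_eq]; simp⟩

/-- Open boxes in Euclidean space. -/
def openBox (l u : Fin 3 → ℝ) : Set E3 := {x | ∀ i, x i ∈ Set.Ioo (l i) (u i)}

/-- Closed boxes in Euclidean space. -/
def closedBox (l u : Fin 3 → ℝ) : Set E3 := {x | ∀ i, x i ∈ Set.Icc (l i) (u i)}

theorem isOpen_openBox (l u : Fin 3 → ℝ) : IsOpen (openBox l u) := by
  have : openBox l u = ⋂ i, {x : E3 | x i ∈ Set.Ioo (l i) (u i)} := by ext; simp [openBox]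
  rw [this]
  exact isOpen_iInter_of_finite fun i => isOpen_Ioo.preimage (by fun_prop)

theorem openBox_subset_closedBox (l u : Fin 3 → ℝ) : openBox l u ⊆ closedBox l u :=
  fun _ hx i => Set.Ioo_subset_Icc_self (hx i)

theorem isCompact_closedBox (l u : Fin 3 → ℝ) : IsCompact (closedBox l u) := by
  have : closedBox l u = (PiLp.homeomorph 2 (fun _ : Fin 3 => ℝ)) ⁻¹' Set.Icc l u := by
    ext x; simp [closedBox, Set.mem_Icc, Pi.le_def, forall_and, PiLp.homeomorph]
  rw [this]
  exact (PiLp.homeomorph 2 (fun _ : Fin 3 => ℝ)).isCompact_preimage.2 isCompact_Icc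

theorem volume_openBox {l u : Fin 3 → ℝ} (h : l ≤ u) :
    volume.real (openBox l u) = ∏ i, (u i - l i) := by
  have : openBox l u = (@WithLp.ofLp 2 (Fin 3 → ℝ)) ⁻¹' Set.pi Set.univ fun i => Set.Ioo (l i) (u i) := by
    ext x; simp [openBox]
  rw [measureReal_def, this, (PiLp.volume_preserving_ofLp (Fin 3)).measure_preimage
    (MeasurableSet.univ_pi fun i => measurableSet_Ioo).nullMeasurableSet,
    Real.volume_pi_Ioo_toReal h]

theorem volume_closedBox {l u : Fin 3 → ℝ} (h : l ≤ u) :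
    volume.real (closedBox l u) = ∏ i, (u i - l i) := by
  have : closedBox l u = (@WithLp.ofLp 2 (Fin 3 → ℝ)) ⁻¹' Set.Icc l u := by
    ext x; simp [closedBox, Set.mem_Icc, Pi.le_def, forall_and]
  rw [measureReal_def, this, (PiLp.volume_preserving_ofLp (Fin 3)).measure_preimage
    measurableSet_Icc.nullMeasurableSet, Real.volume_Icc_pi_toReal h]

/-- The gradient of a separated function `h(x₀) χ(x₁) χ(x₂)` times a fixed vector. -/
theorem gradM_separated {h χ : ℝ → ℝ} (hh : ContDiff ℝ ∞ h) (hχ : ContDiff ℝ ∞ χ) (a : E3) (x : E3) :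
    gradM (fun x : E3 => (h (x 0) * χ (x 1) * χ (x 2)) • a) x =
      Matrix.vecMulVec a.ofLp ![deriv h (x 0) * χ (x 1) * χ (x 2),
        h (x 0) * deriv χ (x 1) * χ (x 2), h (x 0) * χ (x 1) * deriv χ (x 2)] := by
  have hp : ∀ (f : ℝ → ℝ) (_ : ContDiff ℝ ∞ f) (i : Fin 3),
      HasFDerivAt (fun x : E3 => f (x i))
        (deriv f (x i) • (EuclideanSpace.proj i : E3 →L[ℝ] ℝ)) x := by
    intro f hf i
    exact ((hf.differentiable (by simp)) (x i)).hasDerivAt.comp_hasFDerivAt x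
      (EuclideanSpace.proj i : E3 →L[ℝ] ℝ).hasFDerivAt
  have h1 := (((hp h hh 0).mul (hp χ hχ 1)).mul (hp χ hχ 2)).smul_const a
  ext i k
  have e : fderiv ℝ (fun x : E3 => (h (x 0) * χ (x 1) * χ (x 2)) • a) x = _ := h1.fderiv
  rw [gradM_apply, e, Matrix.vecMulVec_apply]
  fin_cases k <;> simp <;> ring

theorem contDiff_separated {h χ : ℝ → ℝ} (hh : ContDiff ℝ ∞ h) (hχ : ContDiff ℝ ∞ χ) (a : E3) :
    ContDiff ℝ ∞ (fun x : E3 => (h (x 0) * χ (x 1) * χ (x 2)) • a) := by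
  have hp : ∀ i : Fin 3, ContDiff ℝ ∞ fun x : E3 => x i := fun i =>
    (EuclideanSpace.proj i : E3 →L[ℝ] ℝ).contDiff
  have h1 : ContDiff ℝ ∞ fun x : E3 => h (x 0) * χ (x 1) * χ (x 2) :=
    ((hh.comp (hp 0)).mul (hχ.comp (hp 1))).mul (hχ.comp (hp 2))
  exact h1.smul contDiff_const

/-- A perturbation `φ₀` with gradient `B - A` on `U₁` and `C - A` on `U₂` can be refined on these
sets by nearly optimal perturbations for `B` and `C`. -/
theorem exists_refined_perturbation {W : M3 → ℝ} (hW : Continuous W) (hW0 : ∀ M, 0 ≤ W M)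
    {A B C : M3} {p q K : ℝ} (hB : IsEnergyBound W B p) (hC : IsEnergyBound W C q)
    {Q U₁ U₂ : Set E3} (hQc : IsCompact Q) (hU₁ : IsOpen U₁) (hU₂ : IsOpen U₂) (hsub1 : U₁ ⊆ Q)
    (hsub2 : U₂ ⊆ Q) (hdisj : Disjoint U₁ U₂) {φ₀ : E3 → E3} (hφ₀ : ContDiff ℝ ∞ φ₀)
    (hs₀ : tsupport φ₀ ⊆ Q) (hg1 : ∀ x ∈ U₁, gradM φ₀ x = B - A)
    (hg2 : ∀ x ∈ U₂, gradM φ₀ x = C - A) (hK : ∀ x ∈ Q, W (A + gradM φ₀ x) ≤ K)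
    {δ : ℝ} (hδ : 0 < δ) :
    ∃ φ : E3 → E3, ContDiff ℝ ∞ φ ∧ tsupport φ ⊆ Q ∧
      ∫ x in Q, W (A + gradM φ x) ≤ p * volume.real U₁ + q * volume.real U₂ +
        K * (volume.real Q - volume.real U₁ - volume.real U₂) + δ := by
  have hm1 : MeasurableSet U₁ := hU₁.measurableSet
  have hm2 : MeasurableSet U₂ := hU₂.measurableSet
  have hU : U₁ ∪ U₂ ⊆ Q := Set.union_subset hsub1 hsub2
  obtain ⟨φ₁, hφ₁, hs₁, -, hq₁⟩ := hB.fill hW hW0 hU₁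
    (hQc.isBounded.subset hsub1) (δ := δ / 2) (by positivity)
  obtain ⟨φ₂, hφ₂, hs₂, -, hq₂⟩ := hC.fill hW hW0 hU₂
    (hQc.isBounded.subset hsub2) (δ := δ / 2) (by positivity)
  let φ : E3 → E3 := fun x => φ₀ x + (φ₁ x + φ₂ x)
  have hφs : ContDiff ℝ ∞ φ := hφ₀.add (hφ₁.add hφ₂)
  have hg : ∀ x, gradM φ x = gradM φ₀ x + (gradM φ₁ x + gradM φ₂ x) := fun x => by
    rw [gradM_add hφ₀ (hφ₁.add hφ₂), gradM_add hφ₁ hφ₂]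
  have hint : IntegrableOn (fun x => W (A + gradM φ x)) Q :=
    integrableOn_energy hW A hφs hQc.isBounded
  refine ⟨φ, hφs, ?_, ?_⟩
  · refine closure_minimal ?_ hQc.isClosed
    intro x hx
    by_contra hxQ
    refine hx ?_
    simp only [φ, image_eq_zero_of_notMem_tsupport (fun hc => hxQ (hs₀ hc)),
      image_eq_zero_of_notMem_tsupport (fun hc => hxQ (hsub1 (hs₁ hc))),
      image_eq_zero_of_notMem_tsupport (fun hc => hxQ (hsub2 (hs₂ hc))), add_zero]
  · have hE1 : ∫ x in U₁, W (A + gradM φ x) ≤ p * volume.real U₁ + δ / 2 := by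
      refine le_trans (le_of_eq ?_) hq₁
      refine setIntegral_congr_fun hm1 fun x hx => ?_
      have e2 : gradM φ₂ x = 0 := gradM_eq_zero fun hc => Set.disjoint_left.1 hdisj hx (hs₂ hc)
      simp only [hg, hg1 x hx, e2, add_zero]
      congr 1
      abel
    have hE2 : ∫ x in U₂, W (A + gradM φ x) ≤ q * volume.real U₂ + δ / 2 := by
      refine le_trans (le_of_eq ?_) hq₂
      refine setIntegral_congr_fun hm2 fun x hx => ?_
      have e2 : gradM φ₁ x = 0 := gradM_eq_zero fun hc => Set.disjoint_left.1 hdisj (hs₁ hc) hx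
      simp only [hg, hg2 x hx, e2, zero_add]
      congr 1
      abel
    have hfin : volume (Q \ (U₁ ∪ U₂)) ≠ ⊤ :=
      ((measure_mono Set.sdiff_subset).trans_lt hQc.measure_lt_top).ne
    have hE3 : ∫ x in Q \ (U₁ ∪ U₂), W (A + gradM φ x) ≤ K * volume.real (Q \ (U₁ ∪ U₂)) := by
      calc _ ≤ ∫ x in Q \ (U₁ ∪ U₂), K := by
            refine setIntegral_mono_on (hint.mono_set Set.sdiff_subset)
              (integrableOn_const hfin) (hQc.measurableSet.diff (hm1.union hm2)) fun x hx => ?_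
            have e1 : gradM φ₁ x = 0 := gradM_eq_zero fun hc => hx.2 (Or.inl (hs₁ hc))
            have e2 : gradM φ₂ x = 0 := gradM_eq_zero fun hc => hx.2 (Or.inr (hs₂ hc))
            rw [hg, e1, e2, add_zero, add_zero]
            exact hK x hx.1
        _ = _ := by rw [setIntegral_const, smul_eq_mul, mul_comm]
    have hvr : volume.real (Q \ (U₁ ∪ U₂)) = volume.real Q - volume.real U₁ - volume.real U₂ := by
      rw [measureReal_sdiff hU (hm1.union hm2) hQc.measure_lt_top.ne,
        measureReal_union hdisj hm2 ((measure_mono hsub1).trans_lt hQc.measure_lt_top).ne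
        ((measure_mono hsub2).trans_lt hQc.measure_lt_top).ne]
      ring
    have hsplit : ∫ x in Q, W (A + gradM φ x) = (∫ x in U₁, W (A + gradM φ x)) +
        (∫ x in U₂, W (A + gradM φ x)) + ∫ x in Q \ (U₁ ∪ U₂), W (A + gradM φ x) := by
      rw [← setIntegral_union hdisj hm2 (hint.mono_set hsub1) (hint.mono_set hsub2),
        ← setIntegral_union Set.disjoint_sdiff_right (hQc.measurableSet.diff (hm1.union hm2))
          (hint.mono_set hU) (hint.mono_set Set.sdiff_subset), Set.union_sdiff_cancel hU]
    rw [hsplit, ← hvr]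
    linarith

/-- Energies of all gradients with separated cut-offs are bounded, uniformly in the length of the
cut-offs. -/
theorem exists_energy_bound_vecMulVec {W : M3 → ℝ} (hW : Continuous W) (A : M3) (a : Fin 3 → ℝ)
    (D : ℝ) : ∃ K, 0 ≤ K ∧ ∀ w : Fin 3 → ℝ, (∀ i, |w i| ≤ D) →
      W (A + Matrix.vecMulVec a w) ≤ K := by
  have hc : Continuous fun w : Fin 3 → ℝ => W (A + Matrix.vecMulVec a w) := by
    refine hW.comp (continuous_const.add ?_)
    exact continuous_matrix fun i j => by simp only [Matrix.vecMulVec_apply]; fun_prop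
  obtain ⟨K, hK⟩ := (isCompact_closedBall (0 : Fin 3 → ℝ) D).exists_bound_of_continuousOn
    hc.continuousOn
  refine ⟨max K 0, le_max_right _ _, fun w hw => (le_abs_self _).trans
    ((hK w ?_).trans (le_max_left _ _))⟩
  rw [mem_closedBall_zero_iff, pi_norm_le_iff_of_nonneg ((abs_nonneg _).trans (hw 0))]
  exact hw

/-- For every small `η` and large `L` there is a perturbation on the box `[0,1] × [0,L]²` whose
gradients are `(1 - θ) a ⊗ e₀` and `-θ a ⊗ e₀` on two boxes which exhaust the whole box as `η → 0` and
`L → ∞`, and are of the form `a ⊗ w` with `w` bounded uniformly in `η` and `L` elsewhere. -/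
theorem exists_box_perturbation (a : E3) {θ : ℝ} (h0 : 0 < θ) (h1 : θ < 1) :
    ∃ D : ℝ, ∀ η L : ℝ, 0 < η → η ≤ 1 / 4 → 4 ≤ L →
      ∃ (Q U₁ U₂ : Set E3) (φ : E3 → E3), IsCompact Q ∧ (interior Q).Nonempty ∧ IsOpen U₁ ∧
        IsOpen U₂ ∧ U₁ ⊆ Q ∧ U₂ ⊆ Q ∧ Disjoint U₁ U₂ ∧ ContDiff ℝ ∞ φ ∧ tsupport φ ⊆ Q ∧
        (∀ x ∈ U₁, gradM φ x = (1 - θ) • Matrix.vecMulVec a.ofLp ![1, 0, 0]) ∧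
        (∀ x ∈ U₂, gradM φ x = (-θ) • Matrix.vecMulVec a.ofLp ![1, 0, 0]) ∧
        (∀ x, ∃ w : Fin 3 → ℝ, (∀ i, |w i| ≤ D) ∧ gradM φ x = Matrix.vecMulVec a.ofLp w) ∧
        volume.real Q = L ^ 2 ∧ volume.real U₁ = θ * (1 - 2 * η) * (L - 2) ^ 2 ∧
        volume.real U₂ = (1 - θ) * (1 - 2 * η) * (L - 2) ^ 2 := by
  obtain ⟨D, hD0, hD⟩ := exists_interval_cutoff
  refine ⟨1 + D, fun η L hη0 hη4 hL4 => ?_⟩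
  obtain ⟨h, hhs, hhz, hh1, hhd, hhl, hhr⟩ := exists_sawtooth_profile h0 h1 hη0 (by linarith)
  obtain ⟨χ, hχs, hχz, hχ1, hχd, hχc⟩ := hD L
  have h1' : 0 < 1 - θ := by linarith
  have hle1 : ![θ * η, 1, 1] ≤ ![θ * (1 - η), L - 1, L - 1] := by
    intro i; fin_cases i <;> simp <;> nlinarith
  have hle2 : ![θ + (1 - θ) * η, 1, 1] ≤ ![θ + (1 - θ) * (1 - η), L - 1, L - 1] := by
    intro i; fin_cases i <;> simp <;> nlinarith
  have hleQ : ![(0 : ℝ), 0, 0] ≤ ![1, L, L] := by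
    intro i; fin_cases i <;> simp <;> linarith
  refine ⟨closedBox ![0, 0, 0] ![1, L, L], openBox ![θ * η, 1, 1] ![θ * (1 - η), L - 1, L - 1],
    openBox ![θ + (1 - θ) * η, 1, 1] ![θ + (1 - θ) * (1 - η), L - 1, L - 1],
    fun x : E3 => (h (x 0) * χ (x 1) * χ (x 2)) • a, isCompact_closedBox _ _, ?_,
    isOpen_openBox _ _, isOpen_openBox _ _, ?_, ?_, ?_, contDiff_separated hhs hχs a, ?_, ?_, ?_,
    ?_, ?_, ?_, ?_⟩
  · refine ⟨WithLp.toLp 2 ![1 / 2, 2, 2], interior_maximal (openBox_subset_closedBox _ _)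
      (isOpen_openBox _ _) ?_⟩
    intro i
    fin_cases i <;> simp <;> norm_num <;> linarith
  · intro x hx i
    have := hx i
    fin_cases i <;> simp at this ⊢ <;> constructor <;> nlinarith
  · intro x hx i
    have := hx i
    fin_cases i <;> simp at this ⊢ <;> constructor <;> nlinarith
  · rw [Set.disjoint_left]
    intro x hx hx'
    have e1 := (hx 0).2
    have e2 := (hx' 0).1
    simp at e1 e2
    nlinarith
  · refine closure_minimal ?_ (isCompact_closedBox _ _).isClosed
    intro x hx
    by_contra hxQ
    refine hx ?_
    simp only [closedBox, Set.mem_ofPred_eq, not_forall] at hxQ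
    obtain ⟨i, hi⟩ := hxQ
    fin_cases i
    · simp only; rw [hhz (x 0) (by simpa using hi)]; simp
    · simp only; rw [hχz (x 1) (by simpa using hi)]; simp
    · simp only; rw [hχz (x 2) (by simpa using hi)]; simp
  · intro x hx
    rw [gradM_separated hhs hχs, (hχc _ (by simpa using hx 1)).1,
      (hχc _ (by simpa using hx 1)).2, (hχc _ (by simpa using hx 2)).1,
      (hχc _ (by simpa using hx 2)).2, hhl _ (by simpa using hx 0)]
    ext i k
    simp only [Matrix.smul_apply, Matrix.vecMulVec_apply]
    fin_cases k <;> simp; ring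
  · intro x hx
    rw [gradM_separated hhs hχs, (hχc _ (by simpa using hx 1)).1,
      (hχc _ (by simpa using hx 1)).2, (hχc _ (by simpa using hx 2)).1,
      (hχc _ (by simpa using hx 2)).2, hhr _ (by simpa using hx 0)]
    ext i k
    simp only [Matrix.smul_apply, Matrix.vecMulVec_apply]
    fin_cases k <;> simp; ring
  · intro x
    refine ⟨_, ?_, gradM_separated hhs hχs a x⟩
    have b1 := hhd (x 0)
    have b2 := hh1 (x 0)
    have b3 := hχ1 (x 1)
    have b4 := hχ1 (x 2)
    have b5 := hχd (x 1)
    have b6 := hχd (x 2)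
    have m1 : |h (x 0)| * |χ (x 1)| ≤ 1 := mul_le_one₀ b2 (abs_nonneg _) b3
    have m2 : |h (x 0)| * |deriv χ (x 1)| ≤ D := by
      calc _ ≤ 1 * D := by gcongr
        _ = D := one_mul D
    intro i
    fin_cases i
    · simp only [abs_mul, Fin.zero_eta, Matrix.cons_val_zero]
      have : |deriv h (x 0)| * |χ (x 1)| * |χ (x 2)| ≤ 1 :=
        mul_le_one₀ (mul_le_one₀ b1 (abs_nonneg _) b3) (abs_nonneg _) b4
      linarith
    · simp only [abs_mul, Fin.mk_one, Matrix.cons_val_one, Matrix.cons_val_zero]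
      calc _ ≤ D * 1 := by gcongr
        _ ≤ _ := by linarith
    · simp only [abs_mul, Fin.reduceFinMk, Matrix.cons_val]
      calc _ ≤ 1 * D := by gcongr
        _ ≤ _ := by linarith
  · rw [volume_closedBox hleQ, Fin.prod_univ_three]; simp; ring
  · rw [volume_openBox hle1, Fin.prod_univ_three]; simp; ring
  · rw [volume_openBox hle2, Fin.prod_univ_three]; simp; ring

/-- Lamination in the direction `e₀`: if `B - C = a ⊗ e₀`, then energy bounds for `B` and `C`
combine convexly, up to an arbitrarily small error. -/
theorem IsEnergyBound.laminate_single {W : M3 → ℝ} (hW : Continuous W) (hW0 : ∀ M, 0 ≤ W M)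
    {B C : M3} {a : E3} (hBC : B - C = Matrix.vecMulVec a.ofLp ![1, 0, 0])
    {θ : ℝ} (h0 : 0 < θ) (h1 : θ < 1) {p q : ℝ} (hB : IsEnergyBound W B p)
    (hC : IsEnergyBound W C q) {δ : ℝ} (hδ : 0 < δ) :
    IsEnergyBound W (θ • B + (1 - θ) • C) (θ * p + (1 - θ) * q + δ) := by
  have hp0 := hB.nonneg hW0
  have hq0 := hC.nonneg hW0
  obtain ⟨D, hD⟩ := exists_box_perturbation a h0 h1
  obtain ⟨K, hK0, hK⟩ := exists_energy_bound_vecMulVec hW (θ • B + (1 - θ) • C) a.ofLp D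
  set κ : ℝ := δ / (16 * (K + 1)) with hκ
  have hκ0 : 0 < κ := by positivity
  have hKκ : K * κ ≤ δ / 16 := by
    rw [hκ, mul_div_assoc', div_le_div_iff₀ (by positivity) (by norm_num)]
    nlinarith
  set η : ℝ := min κ (1 / 4) with hη
  have hη0 : 0 < η := by positivity
  have hη4 : η ≤ 1 / 4 := min_le_right _ _
  have hηκ : η ≤ κ := min_le_left _ _
  set L : ℝ := max κ⁻¹ 4 with hL
  have hL4 : 4 ≤ L := le_max_right _ _
  have hLκ : 1 ≤ κ * L := by
    have : κ⁻¹ ≤ L := le_max_left _ _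
    rwa [inv_le_iff_one_le_mul₀' hκ0] at this
  obtain ⟨Q, U₁, U₂, φ₀, hQc, hQi, hU₁, hU₂, hsub1, hsub2, hdisj, hφ₀, hs₀, hg1, hg2, hgw, hvQ,
    hv1, hv2⟩ := hD η L hη0 hη4 hL4
  obtain ⟨φ, hφ, hs, hle⟩ := exists_refined_perturbation hW hW0
    (A := θ • B + (1 - θ) • C) (K := K) hB hC hQc hU₁ hU₂ hsub1
    hsub2 hdisj hφ₀ hs₀ (fun x hx => by rw [hg1 x hx, ← hBC]; module)
    (fun x hx => by rw [hg2 x hx, ← hBC]; module)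
    (fun x _ => by obtain ⟨w, hw, e⟩ := hgw x; rw [e]; exact hK w hw)
    (δ := δ / 2) (by positivity)
  refine ⟨Q, φ, hQc, hQi, hφ, hs, hle.trans ?_⟩
  rw [hvQ, hv1, hv2]
  -- the transition layers occupy a fraction at most `2 η + 4 / L` of the box
  have hrest : L ^ 2 - (1 - 2 * η) * (L - 2) ^ 2 ≤ 6 * κ * L ^ 2 := by
    have e1 : L ^ 2 - (1 - 2 * η) * (L - 2) ^ 2 ≤ 2 * η * L ^ 2 + 4 * L := by nlinarith
    nlinarith
  have hE3' : K * (L ^ 2 - (1 - 2 * η) * (L - 2) ^ 2) ≤ 6 * (δ / 16) * L ^ 2 := by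
    calc _ ≤ K * (6 * κ * L ^ 2) := by gcongr
      _ = 6 * (K * κ) * L ^ 2 := by ring
      _ ≤ 6 * (δ / 16) * L ^ 2 := by gcongr
  have hfrac : (1 - 2 * η) * (L - 2) ^ 2 ≤ L ^ 2 := by nlinarith
  have hE1' : p * (θ * (1 - 2 * η) * (L - 2) ^ 2) ≤ θ * p * L ^ 2 := by
    calc _ = θ * p * ((1 - 2 * η) * (L - 2) ^ 2) := by ring
      _ ≤ _ := by gcongr
  have hE2' : q * ((1 - θ) * (1 - 2 * η) * (L - 2) ^ 2) ≤ (1 - θ) * q * L ^ 2 := by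
    calc _ = (1 - θ) * q * ((1 - 2 * η) * (L - 2) ^ 2) := by ring
      _ ≤ _ := by have := sub_pos.2 h1; gcongr
  have hL2 : 16 ≤ L ^ 2 := by nlinarith
  have hδL : δ * 16 ≤ δ * L ^ 2 := by gcongr
  linarith

/-! ### Conjugation by rotations and lamination in general directions -/

/-- The second elementary invariant of a `3 × 3` matrix. -/
def secondInvariant (A : M3) : ℝ :=
  A 0 0 * A 1 1 - A 0 1 * A 1 0 + (A 0 0 * A 2 2 - A 0 2 * A 2 0) +
    (A 1 1 * A 2 2 - A 1 2 * A 2 1)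

open Polynomial in
theorem charpoly_fin_three (A : M3) :
    A.charpoly = X ^ 3 - C A.trace * X ^ 2 + C (secondInvariant A) * X - C A.det := by
  rw [Matrix.charpoly, Matrix.det_fin_three, Matrix.trace_fin_three, Matrix.det_fin_three]
  simp [secondInvariant]
  ring

theorem charpoly_eq_of_invariants {A B : M3} (h1 : A.trace = B.trace)
    (h2 : secondInvariant A = secondInvariant B) (h3 : A.det = B.det) :
    A.charpoly = B.charpoly := by
  rw [charpoly_fin_three, charpoly_fin_three, h1, h2, h3]

/-- In odd dimension the conjugation with an orthogonal matrix is a conjugation with a rotation. -/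
theorem exists_SO3_conj_eq {U : M3} (hU : Uᵀ * U = 1) :
    ∃ R ∈ SO3, ∀ A : M3, Rᵀ * A * R = Uᵀ * A * U := by
  have hdet : U.det * U.det = 1 := by
    have := congrArg Matrix.det hU
    rwa [Matrix.det_mul, Matrix.det_transpose, Matrix.det_one] at this
  rcases mul_self_eq_one_iff.1 hdet with h | h
  · refine ⟨U, Matrix.mem_specialOrthogonalGroup_iff.2 ⟨?_, h⟩, fun A => rfl⟩
    rw [Matrix.mem_orthogonalGroup_iff']
    simpa [Matrix.star_eq_conjTranspose] using hU
  · refine ⟨-U, Matrix.mem_specialOrthogonalGroup_iff.2 ⟨?_, ?_⟩, fun A => by simp⟩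
    · rw [Matrix.mem_orthogonalGroup_iff']
      simpa [Matrix.star_eq_conjTranspose] using hU
    · rw [Matrix.det_neg, h]; norm_num

theorem isHermitian_of_isSymm {A : M3} (hA : A.IsSymm) : A.IsHermitian := by
  rw [Matrix.IsHermitian, Matrix.conjTranspose_eq_transpose_of_trivial]; exact hA

theorem isSymm_conj {A : M3} (hA : A.IsSymm) (R : M3) : (Rᵀ * A * R).IsSymm := by
  rw [Matrix.IsSymm, Matrix.transpose_mul, Matrix.transpose_mul, Matrix.transpose_transpose,
    hA.eq, Matrix.mul_assoc]

theorem exists_orthogonal_diagonal {A : M3} (hA : A.IsSymm) :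
    ∃ U : M3, Uᵀ * U = 1 ∧ U * Uᵀ = 1 ∧
      A = U * Matrix.diagonal (isHermitian_of_isSymm hA).eigenvalues * Uᵀ := by
  have hH := isHermitian_of_isSymm hA
  refine ⟨hH.eigenvectorUnitary, ?_, ?_, ?_⟩
  · have := Unitary.coe_star_mul_self hH.eigenvectorUnitary
    simpa [Matrix.star_eq_conjTranspose] using this
  · have := Unitary.coe_mul_star_self hH.eigenvectorUnitary
    simpa [Matrix.star_eq_conjTranspose] using this
  · have := hH.spectral_theorem
    rw [Unitary.conjStarAlgAut_apply] at this
    rw [← Matrix.conjTranspose_eq_transpose_of_trivial, ← Matrix.star_eq_conjTranspose]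
    exact this

/-- Every symmetric matrix is diagonal in a positively oriented orthonormal basis. -/
theorem exists_SO3_diagonal {A : M3} (hA : A.IsSymm) :
    ∃ R ∈ SO3, ∃ a : Fin 3 → ℝ, Rᵀ * A * R = Matrix.diagonal a := by
  obtain ⟨U, hU, hU', h⟩ := exists_orthogonal_diagonal hA
  obtain ⟨R, hR, hRU⟩ := exists_SO3_conj_eq hU
  refine ⟨R, hR, (isHermitian_of_isSymm hA).eigenvalues, ?_⟩
  rw [hRU]
  conv_lhs => rw [h]
  rw [show ∀ D : M3, Uᵀ * (U * D * Uᵀ) * U = (Uᵀ * U) * D * (Uᵀ * U) from fun D => by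
    simp only [Matrix.mul_assoc], hU, one_mul, mul_one]

/-- Symmetric matrices with the same characteristic polynomial are conjugate by a rotation. -/
theorem exists_SO3_conj_of_charpoly_eq {A B : M3} (hA : A.IsSymm) (hB : B.IsSymm)
    (h : A.charpoly = B.charpoly) : ∃ R ∈ SO3, Rᵀ * A * R = B := by
  have he := (Matrix.IsHermitian.eigenvalues_eq_eigenvalues_iff (isHermitian_of_isSymm hA)
    (isHermitian_of_isSymm hB)).2 h
  obtain ⟨U, hU, hU', hAU⟩ := exists_orthogonal_diagonal hA
  obtain ⟨V, hV, hV', hBV⟩ := exists_orthogonal_diagonal hB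
  have hUV : (U * Vᵀ)ᵀ * (U * Vᵀ) = 1 := by
    rw [Matrix.transpose_mul, Matrix.transpose_transpose, Matrix.mul_assoc, ← Matrix.mul_assoc Uᵀ,
      hU, one_mul, hV']
  obtain ⟨R, hR, hRU⟩ := exists_SO3_conj_eq hUV
  refine ⟨R, hR, ?_⟩
  rw [hRU, hBV, ← he]
  conv_lhs => rw [hAU]
  rw [Matrix.transpose_mul, Matrix.transpose_transpose]
  rw [show ∀ D : M3, V * Uᵀ * (U * D * Uᵀ) * (U * Vᵀ) = V * ((Uᵀ * U) * D * (Uᵀ * U)) * Vᵀ from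
    fun D => by simp only [Matrix.mul_assoc], hU, one_mul, mul_one]

theorem sum_sq_of_norm_eq_one {n : E3} (hn : ‖n‖ = 1) : n 0 ^ 2 + n 1 ^ 2 + n 2 ^ 2 = 1 := by
  have := EuclideanSpace.norm_sq_eq n
  rw [hn, Fin.sum_univ_three] at this
  simpa using this.symm

theorem isSymm_tensorSq (n : E3) : (tensorSq n).IsSymm := by
  ext i j; simp [tensorSq, Matrix.vecMulVec_apply, mul_comm]

theorem exists_SO3_conj_tensorSq {n : E3} (hn : ‖n‖ = 1) :
    ∃ R ∈ SO3, Rᵀ * tensorSq n * R = Matrix.vecMulVec ![1, 0, 0] ![1, 0, 0] := by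
  have h := sum_sq_of_norm_eq_one hn
  refine exists_SO3_conj_of_charpoly_eq (isSymm_tensorSq n) ?_ (charpoly_eq_of_invariants ?_ ?_ ?_)
  · exact Matrix.transpose_vecMulVec _ _
  · simp only [Matrix.trace_fin_three, tensorSq, Matrix.vecMulVec_apply]; simp; nlinarith
  · simp [secondInvariant, tensorSq, Matrix.vecMulVec_apply]; ring
  · simp [Matrix.det_fin_three, tensorSq, Matrix.vecMulVec_apply]; ring

/-- Lamination between two matrices differing by a multiple of `n ⊗ n`. -/
theorem IsEnergyBound.laminate {W : M3 → ℝ} (hW : Continuous W) (hW0 : ∀ M, 0 ≤ W M)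
    (hinv : ∀ R ∈ SO3, ∀ M, W (Rᵀ * M * R) = W M)
    {B C : M3} {n : E3} (hn : ‖n‖ = 1) {c : ℝ} (hBC : B - C = c • tensorSq n)
    {θ : ℝ} (h0 : 0 < θ) (h1 : θ < 1) {p q : ℝ} (hB : IsEnergyBound W B p)
    (hC : IsEnergyBound W C q) {δ : ℝ} (hδ : 0 < δ) :
    IsEnergyBound W (θ • B + (1 - θ) • C) (θ * p + (1 - θ) * q + δ) := by
  obtain ⟨R, hR, hRn⟩ := exists_SO3_conj_tensorSq hn
  have h := (IsEnergyBound.laminate_single hW hW0 (a := WithLp.toLp 2 (c • ![1, 0, 0]))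
    (B := Rᵀ * B * R) (C := Rᵀ * C * R) (by
      rw [← Matrix.sub_mul, ← Matrix.mul_sub, hBC, Matrix.mul_smul, Matrix.smul_mul, hRn,
        Matrix.smul_vecMulVec]) h0 h1
      (hB.conj hinv hR) (hC.conj hinv hR) hδ).conj hinv (transpose_mem_SO3 hR)
  have e : ∀ M : M3, R * (Rᵀ * M * R) * Rᵀ = M := fun M => by
    rw [show R * (Rᵀ * M * R) * Rᵀ = (R * Rᵀ) * M * (R * Rᵀ) by simp only [Matrix.mul_assoc],
      mul_transpose_self_of_mem_SO3 hR, one_mul, mul_one]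
  rw [Matrix.transpose_transpose, Matrix.mul_add, Matrix.add_mul, Matrix.mul_smul, Matrix.smul_mul,
    Matrix.mul_smul, Matrix.smul_mul, e, e] at h
  exact h

/-! ### The energy density -/

theorem frobenius_norm_sq (M : M3) : ‖M‖ ^ 2 = (Mᵀ * M).trace := by
  rw [Matrix.frobenius_norm_def, ← Real.sqrt_eq_rpow, Real.sq_sqrt (by positivity)]
  simp [Matrix.trace, Matrix.mul_apply, Fin.sum_univ_three]
  ring

theorem norm_conj {R : M3} (hR : R ∈ SO3) (M : M3) : ‖Rᵀ * M * R‖ = ‖M‖ := by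
  refine (pow_left_inj₀ (norm_nonneg _) (norm_nonneg _) two_ne_zero).1 ?_
  rw [frobenius_norm_sq, frobenius_norm_sq, Matrix.transpose_mul, Matrix.transpose_mul,
    Matrix.transpose_transpose,
    show Rᵀ * (Mᵀ * R) * (Rᵀ * M * R) = Rᵀ * (Mᵀ * (R * Rᵀ) * M * R) by
      simp only [Matrix.mul_assoc], mul_transpose_self_of_mem_SO3 hR, mul_one, Matrix.trace_mul_comm,
      Matrix.mul_assoc, mul_transpose_self_of_mem_SO3 hR, mul_one]

theorem smul_mem_KSet {S M : M3} (h : M ∈ KSet S) (c : ℝ) : c • M ∈ KSet S := by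
  obtain ⟨l, R, hR, rfl⟩ := h
  exact ⟨c * l, R, hR, by rw [smul_smul]⟩

theorem smul_self_mem_KSet (S : M3) (c : ℝ) : c • S ∈ KSet S :=
  ⟨c, 1, one_mem _, by simp⟩

theorem conj_mem_KSet {S M R : M3} (h : M ∈ KSet S) (hR : R ∈ SO3) : Rᵀ * M * R ∈ KSet S := by
  obtain ⟨l, R', hR', rfl⟩ := h
  refine ⟨l, R' * R, mul_mem hR' hR, ?_⟩
  rw [Matrix.transpose_mul, Matrix.mul_smul, Matrix.smul_mul]
  simp only [Matrix.mul_assoc]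

theorem infDist_conj_KSet (S : M3) {R : M3} (hR : R ∈ SO3) (M : M3) :
    Metric.infDist (Rᵀ * M * R) (KSet S) = Metric.infDist M (KSet S) := by
  have hiso : Isometry fun M : M3 => Rᵀ * M * R := by
    refine Isometry.of_dist_eq fun M N => ?_
    rw [dist_eq_norm, dist_eq_norm, ← Matrix.sub_mul, ← Matrix.mul_sub, norm_conj hR]
  have himg : (fun M : M3 => Rᵀ * M * R) '' KSet S = KSet S := by
    ext N
    constructor
    · rintro ⟨M, hM, rfl⟩; exact conj_mem_KSet hM hR
    · intro hN
      refine ⟨R * N * Rᵀ, ?_, ?_⟩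
      · simpa using conj_mem_KSet hN (transpose_mem_SO3 hR)
      · simp only
        rw [show Rᵀ * (R * N * Rᵀ) * R = (Rᵀ * R) * N * (Rᵀ * R) by simp only [Matrix.mul_assoc],
          transpose_mul_self_of_mem_SO3 hR, one_mul, mul_one]
  conv_lhs => rw [← himg]
  exact Metric.infDist_image hiso

theorem infDist_smul_KSet (S : M3) {c : ℝ} (hc : 0 < c) (M : M3) :
    Metric.infDist (c • M) (KSet S) = c * Metric.infDist M (KSet S) := by
  have himg : c • KSet S = KSet S := by
    ext N
    rw [Set.mem_smul_set]
    constructor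
    · rintro ⟨M, hM, rfl⟩; exact smul_mem_KSet hM c
    · intro hN
      exact ⟨c⁻¹ • N, smul_mem_KSet hN _, by rw [smul_smul, mul_inv_cancel₀ hc.ne', one_smul]⟩
  conv_lhs => rw [← himg]
  rw [infDist_smul₀ hc.ne', Real.norm_eq_abs, abs_of_pos hc]

/-- The cubic energy density `e |M|³ + dist(M, K(S))³`. -/
noncomputable def cubicEnergy (S : M3) (e : ℝ) (M : M3) : ℝ :=
  e * ‖M‖ ^ 3 + Metric.infDist M (KSet S) ^ 3

theorem continuous_cubicEnergy (S : M3) (e : ℝ) : Continuous (cubicEnergy S e) := by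
  have := Metric.continuous_infDist_pt (KSet S)
  unfold cubicEnergy
  fun_prop

theorem cubicEnergy_nonneg (S : M3) {e : ℝ} (he : 0 ≤ e) (M : M3) : 0 ≤ cubicEnergy S e M := by
  have := Metric.infDist_nonneg (x := M) (s := KSet S)
  unfold cubicEnergy
  positivity

theorem cubicEnergy_conj (S : M3) (e : ℝ) (R : M3) (hR : R ∈ SO3) (M : M3) :
    cubicEnergy S e (Rᵀ * M * R) = cubicEnergy S e M := by
  rw [cubicEnergy, cubicEnergy, norm_conj hR, infDist_conj_KSet S hR]

theorem cubicEnergy_smul (S : M3) (e : ℝ) {c : ℝ} (hc : 0 < c) (M : M3) :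
    cubicEnergy S e (c • M) = c ^ 3 * cubicEnergy S e M := by
  rw [cubicEnergy, cubicEnergy, infDist_smul_KSet S hc, norm_smul, Real.norm_eq_abs,
    abs_of_pos hc]
  ring

theorem cubicEnergy_self (S : M3) (e : ℝ) : cubicEnergy S e S = e * ‖S‖ ^ 3 := by
  rw [cubicEnergy, Metric.infDist_zero_of_mem (by simpa using smul_self_mem_KSet S 1)]
  simp

theorem cubicEnergy_add_le (S : M3) {e : ℝ} (he : 0 ≤ e) (M E : M3) :
    cubicEnergy S e (M + E) ≤ 4 * cubicEnergy S e M + 4 * (e + 1) * ‖E‖ ^ 3 := by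
  have key : ∀ a b c : ℝ, 0 ≤ a → 0 ≤ b → 0 ≤ c → c ≤ a + b → c ^ 3 ≤ 4 * a ^ 3 + 4 * b ^ 3 := by
    intro a b c ha hb hc h
    have h1 : c ^ 3 ≤ (a + b) ^ 3 := by gcongr
    nlinarith [mul_nonneg (add_nonneg ha hb) (sq_nonneg (a - b))]
  have h1 := key _ _ _ (norm_nonneg M) (norm_nonneg E) (norm_nonneg (M + E)) (norm_add_le M E)
  have h2 := key (Metric.infDist M (KSet S)) ‖E‖ (Metric.infDist (M + E) (KSet S))
    Metric.infDist_nonneg (norm_nonneg E) Metric.infDist_nonneg (by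
      have := Metric.infDist_le_infDist_add_dist (x := M + E) (y := M) (s := KSet S)
      rwa [dist_eq_norm, add_sub_cancel_left] at this)
  unfold cubicEnergy
  nlinarith [mul_le_mul_of_nonneg_left h1 he]

/-! ### The fixed-point estimate for rank-one connections -/

/-- If the values satisfying `P` are bounded below and `P` is stable under the affine contraction
`q ↦ a + k q` up to arbitrarily small errors, then `P` holds for values
arbitrarily close to the fixed point. -/
theorem exists_le_fixed_point {P : ℝ → Prop} (hP0 : ∀ q, P q → 0 ≤ q) (hne : ∃ q, P q) {a k : ℝ}
    (hk0 : 0 ≤ k) (hk1 : k < 1) (h : ∀ q, P q → ∀ δ > 0, P (a + k * q + δ)) {δ : ℝ} (hδ : 0 < δ) :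
    ∃ q, P q ∧ q ≤ a / (1 - k) + δ := by
  have hbdd : BddBelow {q | P q} := ⟨0, fun q hq => hP0 q hq⟩
  set I := sInf {q | P q} with hI
  have hI1 : I ≤ a / (1 - k) := by
    rw [le_div_iff₀ (by linarith)]
    by_contra! hcon
    obtain ⟨q, hq, hlt⟩ := Real.lt_sInf_add_pos (s := {q | P q}) hne
      (ε := (I * (1 - k) - a) / 2) (by linarith)
    have h1 : I ≤ a + k * q + (I * (1 - k) - a) / 4 := csInf_le hbdd (h q hq _ (by linarith))
    nlinarith
  obtain ⟨q, hq, hlt⟩ := Real.lt_sInf_add_pos (s := {q | P q}) hne hδ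
  exact ⟨q, hq, by linarith⟩

theorem conj_transpose_conj {R : M3} (hR : R ∈ SO3) (M : M3) : Rᵀᵀ * (Rᵀ * M * R) * Rᵀ = M := by
  rw [Matrix.transpose_transpose,
    show R * (Rᵀ * M * R) * Rᵀ = (R * Rᵀ) * M * (R * Rᵀ) by simp only [Matrix.mul_assoc],
    mul_transpose_self_of_mem_SO3 hR, one_mul, mul_one]

theorem det_conj {R : M3} (hR : R ∈ SO3) (M : M3) : (Rᵀ * M * R).det = M.det := by
  have := (Matrix.mem_specialOrthogonalGroup_iff.1 hR).2
  rw [Matrix.det_mul, Matrix.det_mul, Matrix.det_transpose, this, one_mul, mul_one]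

theorem trace_conj {R : M3} (hR : R ∈ SO3) (M : M3) : (Rᵀ * M * R).trace = M.trace := by
  rw [Matrix.trace_mul_comm, ← Matrix.mul_assoc, mul_transpose_self_of_mem_SO3 hR, one_mul]

/-- A rank-one perturbation changes the determinant in an affine way. -/
theorem det_smul_diagonal_add_tensorSq (s : Fin 3 → ℝ) (l m : ℝ) (n : E3) :
    (l • Matrix.diagonal s + m • tensorSq n).det = l ^ 3 * (Matrix.diagonal s).det +
      l ^ 2 * m * (n 0 ^ 2 * s 1 * s 2 + n 1 ^ 2 * s 0 * s 2 + n 2 ^ 2 * s 0 * s 1) := by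
  rw [Matrix.det_fin_three, Matrix.det_diagonal, Fin.prod_univ_three]
  simp [tensorSq, Matrix.vecMulVec_apply]
  ring

/-- The central estimate. A rank-one connection makes a rotated copy of `T` the laminate
`θ λ₂ S + (1 - θ) (λ₂ / λ₁) T'` of a multiple of `S` and a rotated multiple `T'` of `T` itself. By
homogeneity the infimum `q` of the energy at `T` satisfies
`q ≤ θ λ₂³ W(S) + (1 - θ) (λ₂ / λ₁)³ q`, and the determinant satisfies the same relation with
equality. -/
theorem energyBound_of_rankOneConnection {s : Fin 3 → ℝ} {T : M3} {l₁ l₂ : ℝ} {R₁ R₂ : M3} {n : E3}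
    (h : IsRankOneConnection (Matrix.diagonal s) T l₁ l₂ R₁ R₂ n) (hl₁ : 0 < l₁) (hl₂ : 0 < l₂)
    (hl₁' : l₁ ≠ 1) (hk0 : 0 ≤ l₁ * (1 - l₂) / (l₂ * (1 - l₁)))
    (hk1 : l₁ * (1 - l₂) / (l₂ * (1 - l₁)) < 1) (hT : 0 < T.det)
    (hS : 0 < (Matrix.diagonal s).det) {e : ℝ} (he : 0 ≤ e) {δ : ℝ} (hδ : 0 < δ) :
    IsEnergyBound (cubicEnergy (Matrix.diagonal s) e) T
      (e * ‖Matrix.diagonal s‖ ^ 3 * (T.det / (Matrix.diagonal s).det) + δ) := by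
  obtain ⟨hR₁, hR₂, hn, h1, h2⟩ := h
  set S : M3 := Matrix.diagonal s with hSdef
  have hinv := cubicEnergy_conj S e
  have hS0 : IsEnergyBound (cubicEnergy S e) S (e * ‖S‖ ^ 3) := by
    rw [← cubicEnergy_self]; exact isEnergyBound_self _ _
  have h1' : 1 - l₁ ≠ 0 := sub_ne_zero.2 (Ne.symm hl₁')
  rcases hk0.eq_or_lt with hk | hk
  · -- here `λ₂ = 1` and `T` is a rotation of `S`
    have hl₂' : l₂ = 1 := by
      have := hk.symm
      rw [div_eq_zero_iff] at this
      rcases this with h | h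
      · rcases mul_eq_zero.1 h with h | h
        · exact absurd h hl₁.ne'
        · linarith
      · rcases mul_eq_zero.1 h with h | h
        · exact absurd h hl₂.ne'
        · exact absurd h h1'
    rw [hl₂'] at h2
    simp only [one_smul, sub_self, zero_smul, add_zero] at h2
    have hd : T.det = S.det := by rw [← det_conj hR₂ T, h2]
    rw [hd, div_self hS.ne', mul_one]
    have := hS0.conj hinv (transpose_mem_SO3 hR₂)
    have h3 : R₂ᵀᵀ * S * R₂ᵀ = T := by rw [← h2, conj_transpose_conj hR₂]
    rw [h3] at this
    exact this.mono (by linarith)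
  · set k := l₁ * (1 - l₂) / (l₂ * (1 - l₁)) with hkdef
    have hd1 : T.det = _ := (det_conj hR₁ T).symm.trans
      ((congrArg Matrix.det h1).trans (det_smul_diagonal_add_tensorSq s l₁ (1 - l₁) n))
    have hd2 : T.det = _ := (det_conj hR₂ T).symm.trans
      ((congrArg Matrix.det h2).trans (det_smul_diagonal_add_tensorSq s l₂ (1 - l₂) n))
    rw [← hSdef] at hd1 hd2
    have hρ : 0 < l₂ / l₁ := by positivity
    have hdet : T.det * (1 - k * (l₂ / l₁) ^ 3) = (1 - k) * l₂ ^ 3 * S.det := by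
      have e1 : ∀ d c : ℝ, l₂ ^ 3 * d + l₂ ^ 2 * (1 - l₂) * c -
          k * (l₂ / l₁) ^ 3 * (l₁ ^ 3 * d + l₁ ^ 2 * (1 - l₁) * c) = (1 - k) * l₂ ^ 3 * d := by
        intro d c
        rw [hkdef]
        field_simp
        ring
      linear_combination hd2 - k * (l₂ / l₁) ^ 3 * hd1 + e1 S.det
        (n 0 ^ 2 * s 1 * s 2 + n 1 ^ 2 * s 0 * s 2 + n 2 ^ 2 * s 0 * s 1)
    have hA : R₂ᵀ * T * R₂ = (1 - k) • (l₂ • S) + (1 - (1 - k)) • ((l₂ / l₁) • (R₁ᵀ * T * R₁)) := by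
      rw [h1, h2]
      have e1 : (1 - k) * l₂ + k * (l₂ / l₁) * l₁ = l₂ := by field_simp; ring
      have e2 : k * (l₂ / l₁) * (1 - l₁) = 1 - l₂ := by rw [hkdef]; field_simp
      calc l₂ • S + (1 - l₂) • tensorSq n
          = ((1 - k) * l₂ + k * (l₂ / l₁) * l₁) • S + (k * (l₂ / l₁) * (1 - l₁)) • tensorSq n := by
            rw [e1, e2]
        _ = _ := by module
    have hstep : ∀ q, IsEnergyBound (cubicEnergy S e) T q → ∀ δ > 0,
        IsEnergyBound (cubicEnergy S e) T
          ((1 - k) * (l₂ ^ 3 * (e * ‖S‖ ^ 3)) + k * (l₂ / l₁) ^ 3 * q + δ) := by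
      intro q hq δ hδ
      have b1 := hS0.smul (fun M => cubicEnergy_smul S e hl₂ M) hl₂.le
      have b2 := (hq.conj hinv hR₁).smul (fun M => cubicEnergy_smul S e hρ M) hρ.le
      have b3 := IsEnergyBound.laminate (continuous_cubicEnergy S e) (cubicEnergy_nonneg S he) hinv
        hn (c := -((l₂ / l₁) * (1 - l₁))) (B := l₂ • S) (C := (l₂ / l₁) • (R₁ᵀ * T * R₁)) (by
          rw [h1, smul_add, smul_smul, smul_smul, div_mul_cancel₀ _ hl₁.ne']
          module) (θ := 1 - k) (by linarith) (by linarith) b1 b2 hδ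
      rw [← hA] at b3
      have b4 := b3.conj hinv (transpose_mem_SO3 hR₂)
      rw [conj_transpose_conj hR₂] at b4
      exact b4.mono (le_of_eq (by ring))
    have hk1' : k * (l₂ / l₁) ^ 3 < 1 := by
      have : 0 < T.det * (1 - k * (l₂ / l₁) ^ 3) := by
        rw [hdet]; have := sub_pos.2 hk1; positivity
      have := (pos_iff_pos_of_mul_pos this).1 hT
      linarith
    obtain ⟨q, hq, hle⟩ := exists_le_fixed_point
      (fun q hq => hq.nonneg (cubicEnergy_nonneg S he)) ⟨_, isEnergyBound_self _ T⟩
      (by positivity) hk1' hstep hδ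
    refine hq.mono (hle.trans (le_of_eq ?_))
    have hne : 1 - k * (l₂ / l₁) ^ 3 ≠ 0 := by linarith
    congr 1
    rw [div_eq_iff hne]
    rw [show e * ‖S‖ ^ 3 * (T.det / S.det) * (1 - k * (l₂ / l₁) ^ 3) =
      e * ‖S‖ ^ 3 * ((T.det * (1 - k * (l₂ / l₁) ^ 3)) / S.det) by ring, hdet]
    field_simp

/-! ### Admissible triples of eigenvalues -/

/-- The algebraic form of the two alternatives defining `𝒯²(S)`, for the triple of eigenvalues
`l s₂, m s₂, z`, where `(l, m)` plays the role of `(λ₁, λ₂)`. -/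
def IsAdmissible (s : Fin 3 → ℝ) (l m z : ℝ) : Prop :=
  0 < l ∧ 0 < m ∧ 0 < z ∧ l * s 1 + m * s 1 + z = 1 ∧
    s 1 * z * (l ^ 2 + l * m + m ^ 2 - l - m) = s 0 * s 2 * (l * m) ∧
    ((l < 1 ∧ l ≤ m ∧ m ≤ 1 ∧ m * s 1 ≤ l * s 2 ∧ l * s 2 ≤ z) ∨
      (1 < l ∧ m ≤ l ∧ 1 ≤ m ∧ l * s 0 ≤ m * s 1 ∧ z ≤ l * s 0))

/-- If `n = (n₁, 0, n₃)`, the invariants of `λ S + (1 - λ) n ⊗ n` are explicit. -/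
theorem charpoly_smul_diagonal_add_tensorSq {s : Fin 3 → ℝ} (hsum : s 0 + s 1 + s 2 = 1) {n : E3}
    (hn1 : n 1 = 0) (hn : n 0 ^ 2 + n 2 ^ 2 = 1) {l y z : ℝ} (htr : l * s 1 + y + z = 1)
    (hyz : l ^ 2 * (s 0 * s 2) + l * (1 - l) * (s 0 * n 2 ^ 2 + s 2 * n 0 ^ 2) = y * z) :
    (l • Matrix.diagonal s + (1 - l) • tensorSq n).charpoly =
      (Matrix.diagonal ![l * s 1, y, z]).charpoly := by
  refine charpoly_eq_of_invariants ?_ ?_ ?_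
  · simp [Matrix.trace_fin_three, tensorSq, Matrix.vecMulVec_apply, -Matrix.trace_vecMulVec,
      -Matrix.trace_add, -Matrix.trace_smul, hn1, Fin.sum_univ_three]
    linear_combination l * hsum + (1 - l) * hn - htr
  · simp [secondInvariant, tensorSq, Matrix.vecMulVec_apply, hn1]
    linear_combination l ^ 2 * s 1 * hsum + hyz + l * (1 - l) * s 1 * hn - l * s 1 * htr
  · simp [Matrix.det_fin_three, tensorSq, Matrix.vecMulVec_apply, hn1, Fin.prod_univ_three]
    linear_combination l * s 1 * hyz

theorem charpoly_diagonal_comp_perm (t : Fin 3 → ℝ) (σ : Equiv.Perm (Fin 3)) :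
    (Matrix.diagonal (t ∘ σ)).charpoly = (Matrix.diagonal t).charpoly := by
  rw [Matrix.charpoly_diagonal, Matrix.charpoly_diagonal]
  exact Equiv.prod_comp σ fun i => Polynomial.X - Polynomial.C (t i)

theorem charpoly_diagonal_swap (x y z : ℝ) :
    (Matrix.diagonal ![x, y, z]).charpoly = (Matrix.diagonal ![y, x, z]).charpoly := by
  rw [Matrix.charpoly_diagonal, Matrix.charpoly_diagonal, Fin.prod_univ_three, Fin.prod_univ_three]
  simp only [Matrix.cons_val_zero, Matrix.cons_val_one, Matrix.cons_val]
  ring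

/-- Admissible triples give rise to rank-one connections, with `n` orthogonal to the middle
eigenvector of `S`. -/
theorem IsAdmissible.exists_rankOneConnection {s : Fin 3 → ℝ} (hs₀ : 0 < s 0) (hs₁ : s 0 < s 1)
    (hs₂ : s 1 < s 2) (hsum : s 0 + s 1 + s 2 = 1) {l m z : ℝ} (h : IsAdmissible s l m z) {T : M3}
    (hT : T.IsSymm) (hTc : T.charpoly = (Matrix.diagonal ![l * s 1, m * s 1, z]).charpoly) :
    ∃ (R₁ R₂ : M3) (n : E3), IsRankOneConnection (Matrix.diagonal s) T l m R₁ R₂ n := by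
  obtain ⟨hl, hm, hz, htr, hrel, hcase⟩ := h
  have h20 : 0 < s 2 - s 0 := by linarith
  have hl1 : 1 - l ≠ 0 := by
    rcases hcase with h | h
    · linarith [h.1]
    · linarith [h.1]
  -- the squares of the components of `n`, read off from the characteristic polynomial at
  -- `l s₁`, `l s₃`
  set a := (m * s 1 - l * s 0) * (z - l * s 0) / ((1 - l) * (l * (s 2 - s 0))) with ha
  set b := (l * s 2 - m * s 1) * (z - l * s 2) / ((1 - l) * (l * (s 2 - s 0))) with hb
  have hden : 0 < l * (s 2 - s 0) := by positivity
  have hab : a + b = 1 := by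
    rw [ha, hb, ← add_div, div_eq_one_iff_eq (mul_ne_zero hl1 hden.ne')]
    linear_combination l * (s 2 - s 0) * htr - l ^ 2 * (s 2 - s 0) * hsum
  have hc : l ^ 2 * (s 0 * s 2) + l * (1 - l) * (s 0 * b + s 2 * a) = m * s 1 * z := by
    rw [ha, hb]
    field_simp
    ring
  have hpos : 0 ≤ a ∧ 0 ≤ b := by
    rcases hcase with ⟨h1, h2, h3, h4, h5⟩ | ⟨h1, h2, h3, h4, h5⟩
    · have e1 : l * s 0 ≤ m * s 1 := by nlinarith
      have e2 : l * s 0 ≤ z := by nlinarith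
      have e3 : 0 < 1 - l := by linarith
      exact ⟨div_nonneg (mul_nonneg (by linarith) (by linarith)) (by positivity),
        div_nonneg (mul_nonneg (by linarith) (by linarith)) (by positivity)⟩
    · have e1 : m * s 1 ≤ l * s 2 := by nlinarith
      have e2 : z ≤ l * s 2 := by nlinarith
      have e3 : (1 - l) * (l * (s 2 - s 0)) ≤ 0 :=
        mul_nonpos_of_nonpos_of_nonneg (by linarith) hden.le
      exact ⟨div_nonneg_of_nonpos (mul_nonpos_of_nonneg_of_nonpos (by linarith) (by linarith)) e3,
        div_nonneg_of_nonpos (mul_nonpos_of_nonneg_of_nonpos (by linarith) (by linarith)) e3⟩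
  let n : E3 := WithLp.toLp 2 ![√a, 0, √b]
  have hn0 : n 0 ^ 2 = a := Real.sq_sqrt hpos.1
  have hn1 : n 1 = 0 := rfl
  have hn2 : n 2 ^ 2 = b := Real.sq_sqrt hpos.2
  have hn : ‖n‖ = 1 := by
    rw [EuclideanSpace.norm_eq, Fin.sum_univ_three]
    simp only [Real.norm_eq_abs, sq_abs, hn0, hn1, hn2]
    norm_num [hab]
  have hc2 : m ^ 2 * (s 0 * s 2) + m * (1 - m) * (s 0 * b + s 2 * a) = l * s 1 * z := by
    refine mul_left_cancel₀ (mul_ne_zero hl.ne' hl1) ?_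
    linear_combination m * (1 - m) * hc - (m - l) * hrel
  have hsymm : ∀ c d : ℝ, (c • Matrix.diagonal s + d • tensorSq n : M3).IsSymm := fun c d =>
    ((Matrix.isSymm_diagonal s).smul c).add ((isSymm_tensorSq n).smul d)
  obtain ⟨R₁, hR₁, e1⟩ := exists_SO3_conj_of_charpoly_eq hT (hsymm l (1 - l))
    (hTc.trans (charpoly_smul_diagonal_add_tensorSq hsum hn1 (by rw [hn0, hn2, hab]) htr
      (by rw [hn0, hn2]; exact hc)).symm)
  obtain ⟨R₂, hR₂, e2⟩ := exists_SO3_conj_of_charpoly_eq hT (hsymm m (1 - m))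
    ((hTc.trans (charpoly_diagonal_swap _ _ _)).trans (charpoly_smul_diagonal_add_tensorSq hsum hn1
      (by rw [hn0, hn2, hab]) (by linarith) (by rw [hn0, hn2]; exact hc2)).symm)
  exact ⟨R₁, R₂, n, hR₁, hR₂, hn, e1, e2⟩

theorem det_diagonal_fin_three (x y z : ℝ) : (Matrix.diagonal ![x, y, z]).det = x * y * z := by
  rw [Matrix.det_diagonal, Fin.prod_univ_three]; rfl

/-- The energy estimate for admissible triples with `l ≠ m`. -/
theorem IsAdmissible.energyBound_of_ne {s : Fin 3 → ℝ} (hs₀ : 0 < s 0) (hs₁ : s 0 < s 1)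
    (hs₂ : s 1 < s 2) (hsum : s 0 + s 1 + s 2 = 1) {l m z : ℝ} (h : IsAdmissible s l m z)
    (hlm : l ≠ m) {e : ℝ} (he : 0 ≤ e) {δ : ℝ} (hδ : 0 < δ) :
    IsEnergyBound (cubicEnergy (Matrix.diagonal s) e) (Matrix.diagonal ![l * s 1, m * s 1, z])
      (e * (‖Matrix.diagonal s‖ ^ 3 / (Matrix.diagonal s).det) + δ) := by
  obtain ⟨R₁, R₂, n, hconn⟩ := h.exists_rankOneConnection hs₀ hs₁ hs₂ hsum
    (Matrix.isSymm_diagonal _) rfl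
  obtain ⟨hl, hm, hz, htr, hrel, hcase⟩ := h
  have h1 : 0 < s 1 := by linarith
  have hk : l ≠ 1 ∧ 0 ≤ l * (1 - m) / (m * (1 - l)) ∧ l * (1 - m) / (m * (1 - l)) < 1 := by
    rcases hcase with ⟨h1, h2, h3, h4, h5⟩ | ⟨h1, h2, h3, h4, h5⟩
    · have e3 : 0 < 1 - l := by linarith
      have e4 : 0 ≤ 1 - m := by linarith
      refine ⟨h1.ne, by positivity, ?_⟩
      rw [div_lt_one (by positivity)]
      have := lt_of_le_of_ne h2 hlm
      linarith
    · have e3 : 0 < l - 1 := by linarith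
      have e4 : 0 ≤ m - 1 := by linarith
      rw [show l * (1 - m) / (m * (1 - l)) = l * (m - 1) / (m * (l - 1)) by
        rw [show l * (1 - m) = -(l * (m - 1)) by ring, show m * (1 - l) = -(m * (l - 1)) by ring,
          neg_div_neg_eq]]
      refine ⟨h1.ne', by positivity, ?_⟩
      rw [div_lt_one (by positivity)]
      have := lt_of_le_of_ne h2 hlm.symm
      linarith
  have hS : 0 < (Matrix.diagonal s).det := by
    rw [Matrix.det_diagonal, Fin.prod_univ_three]
    have : 0 < s 2 := by linarith
    positivity
  have hTd : 0 < (Matrix.diagonal ![l * s 1, m * s 1, z]).det := by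
    rw [det_diagonal_fin_three]; positivity
  refine (energyBound_of_rankOneConnection hconn hl hm hk.1 hk.2.1 hk.2.2 hTd hS he hδ).mono ?_
  have hd1 : (Matrix.diagonal ![l * s 1, m * s 1, z]).det ≤ 1 := by
    rw [det_diagonal_fin_three]
    have e1 : 0 < l * s 1 := by positivity
    have e2 : 0 < m * s 1 := by positivity
    exact mul_le_one₀ (mul_le_one₀ (by linarith) e2.le (by linarith)) hz.le (by linarith)
  rw [mul_assoc]
  gcongr ?_ * ?_ + δ
  rw [mul_div_assoc']
  gcongr
  exact mul_le_of_le_one_right (by positivity) hd1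

/-- An admissible triple with `l = m` is a limit of admissible triples with `l ≠ m`. -/
theorem IsAdmissible.exists_near_ne {s : Fin 3 → ℝ} (hs₀ : 0 < s 0) (hs₁ : s 0 < s 1)
    (hs₂ : s 1 < s 2) (hsum : s 0 + s 1 + s 2 = 1) {l z : ℝ} (h : IsAdmissible s l l z)
    {η : ℝ} (hη : 0 < η) :
    ∃ l' m' z', IsAdmissible s l' m' z' ∧ l' ≠ m' ∧ |l' - l| < η ∧ |m' - l| < η ∧ |z' - z| < η := by
  obtain ⟨hl, -, hz, htr, hrel, hcase⟩ := h
  have h1 : 0 < s 1 := by linarith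
  have h2 : 0 < s 2 := by linarith
  have hz' : z = 1 - 2 * l * s 1 := by linarith
  have hrel' : s 1 * z * (3 * l - 2) = s 0 * s 2 * l := by
    refine mul_left_cancel₀ hl.ne' ?_
    linear_combination hrel
  -- admissible triples `u ± d, 1 - 2 u s₂` correspond to `d² den(u) = -u g(u)`
  let g : ℝ → ℝ := fun u => s 1 * (1 - 2 * u * s 1) * (3 * u - 2) - s 0 * s 2 * u
  let den : ℝ → ℝ := fun u => s 1 * (1 - 2 * u * s 1) + s 0 * s 2
  let d : ℝ → ℝ := fun u => √(-u * g u / den u)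
  have hgl : g l = 0 := by simp only [g]; rw [← hz']; linarith
  have hdenl : 0 < den l := by simp only [den]; rw [← hz']; positivity
  have hgc : Continuous g := by fun_prop
  have hdenc : Continuous den := by fun_prop
  have hdl : d l = 0 := by simp [d, hgl]
  have hdc : ContinuousAt d l :=
    (((continuous_neg.mul hgc).continuousAt).div hdenc.continuousAt hdenl.ne').sqrt
  have hzne : ∀ c, (c = s 2 ∨ c = s 0) → z ≠ l * c := by
    intro c hc he
    have key : (s 1 - s 0) * (s 2 - s 1) = 0 := by
      rcases hc with rfl | rfl
      · have e1 : s 1 * (3 * l - 2) = s 0 := by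
          refine mul_left_cancel₀ (mul_pos hl h2).ne' ?_
          rw [he] at hrel'
          linear_combination hrel'
        have e2 : l * (2 * s 1 + s 2) = 1 := by linarith
        linear_combination (2 * s 1 + s 2) * e1 - 3 * s 1 * e2 + 3 * s 1 * hsum
      · have e1 : s 1 * (3 * l - 2) = s 2 := by
          refine mul_left_cancel₀ (mul_pos hl hs₀).ne' ?_
          rw [he] at hrel'
          linear_combination hrel'
        have e2 : l * (2 * s 1 + s 0) = 1 := by linarith
        linear_combination (2 * s 1 + s 0) * e1 - 3 * s 1 * e2 + 3 * s 1 * hsum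
    exact (mul_pos (sub_pos.2 hs₁) (sub_pos.2 hs₂)).ne' key
  -- `g` is concave, so it is negative on one side of its zero `l`
  obtain ⟨σ, hσ, hneg⟩ : ∃ σ : ℝ, |σ| = 1 ∧ ∀ ε > 0, g (l + σ * ε) < 0 := by
    have hexp : ∀ x, g (l + x) = (s 1 * (3 * z - 2 * s 1 * (3 * l - 2)) - s 0 * s 2) * x -
        6 * s 1 ^ 2 * x ^ 2 := by
      intro x
      have : g (l + x) = g l + ((s 1 * (3 * z - 2 * s 1 * (3 * l - 2)) - s 0 * s 2) * x -
        6 * s 1 ^ 2 * x ^ 2) := by simp only [g, hz']; ring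
      rw [this, hgl, zero_add]
    rcases le_total (s 1 * (3 * z - 2 * s 1 * (3 * l - 2)) - s 0 * s 2) 0 with hs | hs
    · refine ⟨1, by simp, fun ε hε => ?_⟩
      rw [hexp]
      have : 0 < 6 * s 1 ^ 2 * (1 * ε) ^ 2 := by positivity
      nlinarith
    · refine ⟨-1, by simp, fun ε hε => ?_⟩
      rw [hexp]
      have : 0 < 6 * s 1 ^ 2 * (-1 * ε) ^ 2 := by positivity
      nlinarith
  have hut : Tendsto (fun ε : ℝ => l + σ * ε) (𝓝[>] 0) (𝓝 l) := by
    have : Continuous fun ε : ℝ => l + σ * ε := by fun_prop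
    have h := this.tendsto 0
    simp only [mul_zero, add_zero] at h
    exact h.mono_left nhdsWithin_le_nhds
  have hdt : Tendsto (fun ε : ℝ => d (l + σ * ε)) (𝓝[>] 0) (𝓝 0) := by
    have := hdc.tendsto.comp hut
    rwa [hdl] at this
  have hplus := hut.add hdt
  have hminus := hut.sub hdt
  have hzt : Tendsto (fun ε : ℝ => 1 - 2 * (l + σ * ε) * s 1) (𝓝[>] 0) (𝓝 z) := by
    have : Tendsto (fun ε : ℝ => 1 - 2 * (l + σ * ε) * s 1) (𝓝[>] 0) (𝓝 (1 - 2 * l * s 1)) :=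
      ((hut.const_mul 2).mul_const (s 1)).const_sub 1
    rwa [← hz'] at this
  rw [add_zero] at hplus
  rw [sub_zero] at hminus
  have hball : ∀ c : ℝ, ∀ f : ℝ → ℝ, Tendsto f (𝓝[>] 0) (𝓝 c) → ∀ᶠ ε in 𝓝[>] (0 : ℝ), |f ε - c| < η :=
    fun c f hf => by
      have := hf.eventually (Metric.ball_mem_nhds c hη)
      simpa [Real.dist_eq] using this
  have hdent : ∀ᶠ ε in 𝓝[>] (0 : ℝ), 0 < den (l + σ * ε) :=
    (hdenc.tendsto l |>.comp hut).eventually (lt_mem_nhds hdenl)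
  have hpos : ∀ᶠ ε in 𝓝[>] (0 : ℝ), 0 < ε := eventually_mem_nhdsWithin
  -- the relation and the positivity of the deviation `d` near `l`
  have hrelev : ∀ᶠ ε in 𝓝[>] (0 : ℝ), 0 < d (l + σ * ε) ∧
      s 1 * (1 - 2 * (l + σ * ε) * s 1) * (3 * (l + σ * ε) ^ 2 + d (l + σ * ε) ^ 2 -
        2 * (l + σ * ε)) = s 0 * s 2 * ((l + σ * ε) ^ 2 - d (l + σ * ε) ^ 2) := by
    filter_upwards [hdent, hpos, hut.eventually (lt_mem_nhds hl)] with ε hden hε hu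
    have hq : 0 < -(l + σ * ε) * g (l + σ * ε) / den (l + σ * ε) :=
      div_pos (by have := hneg ε hε; nlinarith) hden
    refine ⟨Real.sqrt_pos.2 hq, ?_⟩
    have hd2 : d (l + σ * ε) ^ 2 * den (l + σ * ε) = -(l + σ * ε) * g (l + σ * ε) := by
      simp only [d]
      rw [Real.sq_sqrt hq.le, div_mul_cancel₀ _ hden.ne']
    simp only [g, den] at hd2
    linear_combination hd2
  rcases hcase with ⟨c1, -, -, c4, c5⟩ | ⟨c1, -, -, c4, c5⟩
  · have c5' : l * s 2 < z := lt_of_le_of_ne c5 (hzne _ (Or.inl rfl)).symm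
    have c4' : l * s 1 < l * s 2 := by gcongr
    obtain ⟨ε, ⟨hd0, hr⟩, b1, b2, b3, p1, p2, p3, q1, q4, q5⟩ := (hrelev.and <|
      (hball _ _ hminus).and <| (hball _ _ hplus).and <| (hball _ _ hzt).and <|
      (hminus.eventually (lt_mem_nhds hl)).and <| (hplus.eventually (lt_mem_nhds hl)).and <|
      (hzt.eventually (lt_mem_nhds hz)).and <| (hplus.eventually (gt_mem_nhds c1)).and <|
      ((hplus.mul_const (s 1)).eventually_lt (hminus.mul_const (s 2)) c4').and <|
      (hminus.mul_const (s 2)).eventually_lt hzt c5').exists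
    refine ⟨_, _, _, ⟨p1, p2, p3, by ring, ?_, Or.inl ⟨by linarith, by linarith, q1.le, q4.le,
      q5.le⟩⟩, by linarith, b1, b2, b3⟩
    linear_combination hr
  · have c5' : z < l * s 0 := lt_of_le_of_ne c5 (hzne _ (Or.inr rfl))
    have c4' : l * s 0 < l * s 1 := by gcongr
    obtain ⟨ε, ⟨hd0, hr⟩, b1, b2, b3, p1, p2, p3, q1, q4, q5⟩ := (hrelev.and <|
      (hball _ _ hplus).and <| (hball _ _ hminus).and <| (hball _ _ hzt).and <|
      (hplus.eventually (lt_mem_nhds hl)).and <| (hminus.eventually (lt_mem_nhds hl)).and <|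
      (hzt.eventually (lt_mem_nhds hz)).and <| (hminus.eventually (lt_mem_nhds c1)).and <|
      ((hplus.mul_const (s 0)).eventually_lt (hminus.mul_const (s 1)) c4').and <|
      hzt.eventually_lt (hplus.mul_const (s 0)) c5').exists
    refine ⟨_, _, _, ⟨p1, p2, p3, by ring, ?_, Or.inr ⟨by linarith, by linarith, q1.le, q4.le,
      q5.le⟩⟩, by linarith, b1, b2, b3⟩
    linear_combination hr

/-- The energy estimate for all admissible triples, with a constant depending only on `S`. -/
theorem IsAdmissible.energyBound {s : Fin 3 → ℝ} (hs₀ : 0 < s 0) (hs₁ : s 0 < s 1)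
    (hs₂ : s 1 < s 2) (hsum : s 0 + s 1 + s 2 = 1) {l m z : ℝ} (h : IsAdmissible s l m z) {T : M3}
    (hT : T.IsSymm) (hTc : T.charpoly = (Matrix.diagonal ![l * s 1, m * s 1, z]).charpoly)
    {e : ℝ} (he : 0 < e) :
    IsEnergyBound (cubicEnergy (Matrix.diagonal s) e) T
      (e * (4 * (‖Matrix.diagonal s‖ ^ 3 / (Matrix.diagonal s).det) + 1)) := by
  set c := ‖Matrix.diagonal s‖ ^ 3 / (Matrix.diagonal s).det with hc
  have hS : 0 < (Matrix.diagonal s).det := by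
    rw [Matrix.det_diagonal, Fin.prod_univ_three]
    have h1 : 0 < s 1 := by linarith
    have h2 : 0 < s 2 := by linarith
    positivity
  have hc0 : 0 ≤ c := by positivity
  obtain ⟨R, hR, hRT⟩ := exists_SO3_conj_of_charpoly_eq (Matrix.isSymm_diagonal _) hT hTc.symm
  suffices hD : IsEnergyBound (cubicEnergy (Matrix.diagonal s) e)
      (Matrix.diagonal ![l * s 1, m * s 1, z]) (e * (4 * c + 1)) by
    rw [← hRT]; exact hD.conj (cubicEnergy_conj _ e) hR
  by_cases hlm : l = m
  · subst hlm
    -- the perturbation of the matrix must be small compared with `e`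
    have hcont : Tendsto (fun v : Fin 3 → ℝ => 4 * (e + 1) * ‖(Matrix.diagonal v : M3)‖ ^ 3) (𝓝 0)
        (𝓝 0) := by
      have hd : Continuous fun v : Fin 3 → ℝ => (Matrix.diagonal v : M3) :=
        continuous_id.matrix_diagonal
      have : Continuous fun v : Fin 3 → ℝ => 4 * (e + 1) * ‖(Matrix.diagonal v : M3)‖ ^ 3 := by
        fun_prop
      simpa using this.tendsto 0
    obtain ⟨η, hη, hηE⟩ := Metric.eventually_nhds_iff.1 (hcont.eventually (gt_mem_nhds (half_pos he)))
    have h1 : 0 < s 1 := by linarith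
    have h1' : s 1 ≤ 1 := by linarith
    obtain ⟨l', m', z', hadm, hne, d1, d2, d3⟩ := h.exists_near_ne hs₀ hs₁ hs₂ hsum hη
    have hb := hadm.energyBound_of_ne hs₀ hs₁ hs₂ hsum hne he.le (δ := e / 8) (by positivity)
    set v : Fin 3 → ℝ := ![l * s 1 - l' * s 1, l * s 1 - m' * s 1, z - z'] with hv
    have hsh := hb.shift (continuous_cubicEnergy _ e) (E := Matrix.diagonal v)
      (fun M => cubicEnergy_add_le _ he.le M _) (by norm_num)
    have hsumD : (Matrix.diagonal ![l' * s 1, m' * s 1, z'] : M3) + Matrix.diagonal v =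
        Matrix.diagonal ![l * s 1, l * s 1, z] := by
      rw [Matrix.diagonal_add]
      congr 1
      ext i; fin_cases i <;> simp [hv]
    rw [hsumD] at hsh
    have hvη : dist v 0 < η := by
      rw [dist_zero_right, pi_norm_lt_iff hη]
      have key : ∀ w, |w - l| < η → |l * s 1 - w * s 1| < η := by
        intro w hw
        rw [← sub_mul, abs_mul, abs_of_pos h1, abs_sub_comm]
        nlinarith [abs_nonneg (w - l)]
      intro i
      fin_cases i
      · exact key l' d1
      · exact key m' d2
      · simpa [hv, abs_sub_comm] using d3
    have := hηE hvη
    refine hsh.mono ?_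
    rw [← hc]
    linarith
  · refine (h.energyBound_of_ne hs₀ hs₁ hs₂ hsum hlm he.le he).mono ?_
    rw [← hc]
    nlinarith [mul_nonneg he.le hc0]

/-! ### Periodization -/

/-- The integer part of a point, coordinatewise. -/
noncomputable def floorVec (x : E3) : E3 := WithLp.toLp 2 fun i => (⌊x i⌋ : ℝ)

/-- The representative of a point in the half-open unit cell. -/
noncomputable def fractVec (x : E3) : E3 := x - floorVec x

theorem fractVec_apply (x : E3) (i : Fin 3) : fractVec x i = Int.fract (x i) := rfl

/-- The open unit cell. -/
def openCell : Set E3 := openBox 0 1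

theorem fractVec_add_single (x : E3) (i : Fin 3) :
    fractVec (x + EuclideanSpace.single i 1) = fractVec x := by
  ext j
  rw [fractVec_apply, fractVec_apply]
  by_cases h : j = i
  · subst h; simp
  · simp [h]

/-- Near every point, the periodization of a function supported in the open cell is a translate of
this function or vanishes. -/
theorem periodization_eventuallyEq {φ : E3 → E3} (hs : tsupport φ ⊆ openCell)
    (hc : HasCompactSupport φ) (x : E3) :
    ((fun y => φ (fractVec y)) =ᶠ[𝓝 x] fun y => φ (y - floorVec x)) ∨
      (((fun y => φ (fractVec y)) =ᶠ[𝓝 x] fun _ => 0) ∧ fractVec x ∉ tsupport φ) := by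
  by_cases hx : ∀ i, 0 < Int.fract (x i)
  · left
    have : ∀ i : Fin 3, ∀ᶠ y : E3 in 𝓝 x, ⌊y i⌋ = ⌊x i⌋ := by
      intro i
      have hlt : (⌊x i⌋ : ℝ) < x i := by have := hx i; rw [Int.fract] at this; linarith
      have hcont : ContinuousAt (fun y : E3 => y i) x := by fun_prop
      filter_upwards [hcont.eventually (lt_mem_nhds hlt),
        hcont.eventually (gt_mem_nhds (Int.lt_floor_add_one (x i)))] with y h1 h2
      exact Int.floor_eq_iff.2 ⟨h1.le, h2⟩
    filter_upwards [eventually_all.2 this] with y hy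
    congr 1
    ext i
    simp [fractVec, floorVec, hy i]
  · right
    push Not at hx
    obtain ⟨i, hi⟩ := hx
    have hi0 : Int.fract (x i) = 0 := le_antisymm hi (Int.fract_nonneg _)
    constructor
    · -- the support keeps a positive distance from the faces of the cell
      obtain ⟨κ, hκ, hκs⟩ := hc.isCompact.exists_forall_le' (f := fun y : E3 => min (y i) (1 - y i))
        (by fun_prop) (a := 0) (fun y hy => by
          have := hs hy i
          simp only [Pi.zero_apply, Pi.one_apply, Set.mem_Ioo] at this
          exact lt_min this.1 (by linarith [this.2]))
      have hcont : ContinuousAt (fun y : E3 => y i) x := by fun_prop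
      have hxi : x i = ⌊x i⌋ := by rw [Int.fract] at hi0; linarith
      filter_upwards [hcont.eventually (lt_mem_nhds (show x i - κ < x i by linarith)),
        hcont.eventually (gt_mem_nhds (show x i < x i + κ by linarith))] with y h1 h2
      by_contra hne
      have hmem : fractVec y ∈ tsupport φ := subset_tsupport φ hne
      have h3 := hκs _ hmem
      rw [fractVec_apply, le_min_iff] at h3
      have h4 : κ ≤ Int.fract (y i) := h3.1
      have h5 : κ ≤ 1 - Int.fract (y i) := h3.2
      rw [Int.fract] at h4 h5
      have h6 : (⌊y i⌋ : ℝ) < ⌊x i⌋ := by linarith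
      have h7 : (⌊x i⌋ : ℝ) < ⌊y i⌋ + 1 := by linarith
      norm_cast at h6 h7
      omega
    · intro hmem
      have := (hs hmem i).1
      rw [fractVec_apply, hi0] at this
      simp at this

theorem contDiff_periodization {φ : E3 → E3} (hφ : ContDiff ℝ ∞ φ) (hs : tsupport φ ⊆ openCell)
    (hc : HasCompactSupport φ) : ContDiff ℝ ∞ fun y => φ (fractVec y) := by
  rw [contDiff_iff_contDiffAt]
  intro x
  rcases periodization_eventuallyEq hs hc x with h | h
  · exact ((hφ.comp (contDiff_id.sub contDiff_const)).contDiffAt).congr_of_eventuallyEq h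
  · exact contDiffAt_const.congr_of_eventuallyEq h.1

theorem gradM_periodization {φ : E3 → E3} (hs : tsupport φ ⊆ openCell)
    (hc : HasCompactSupport φ) (x : E3) :
    gradM (fun y => φ (fractVec y)) x = gradM φ (fractVec x) := by
  rcases periodization_eventuallyEq hs hc x with h | ⟨h, hx⟩
  · unfold gradM
    rw [h.fderiv_eq, fderiv_comp_sub]
    rfl
  · rw [gradM_eq_zero hx]
    unfold gradM
    rw [h.fderiv_eq]
    simp

/-- The integral of a periodic function over a compact set is controlled by the integral over
the unit cell. -/
theorem exists_lintegral_fractVec_le {Q : Set E3} (hQ : IsCompact Q) :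
    ∃ N : ℕ, ∀ f : E3 → ENNReal, ∫⁻ x in Q, f (fractVec x) ≤ N * ∫⁻ x in openCell, f x := by
  classical
  obtain ⟨ρ, hρ⟩ := hQ.isBounded.subset_closedBall 0
  obtain ⟨n, hn⟩ := exists_nat_ge ρ
  let H : Set E3 := {x | ∀ i, x i ∈ Set.Ico (0 : ℝ) 1}
  have hHm : MeasurableSet H := by
    have : H = ⋂ i, {x : E3 | x i ∈ Set.Ico (0 : ℝ) 1} := by ext; simp [H]
    rw [this]
    exact MeasurableSet.iInter fun i =>
      measurableSet_Ico.preimage (by fun_prop : Continuous fun x : E3 => x i).measurable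
  have hHae : H =ᵐ[volume] openCell := by
    have h1 : openCell ⊆ H := fun x hx i => Set.Ioo_subset_Ico_self (hx i)
    have h2 : H ⊆ closedBox 0 1 := fun x hx i => Set.Ico_subset_Icc_self (hx i)
    have hv : volume (closedBox 0 1) ≤ volume openCell := by
      have e := (volume_closedBox (l := 0) (u := 1) zero_le_one).trans
        (volume_openBox (l := 0) (u := 1) zero_le_one).symm
      have hf1 := (isCompact_closedBox 0 1).measure_lt_top (μ := volume).ne
      have hf2 : volume openCell ≠ ⊤ :=
        ((measure_mono (openBox_subset_closedBox 0 1)).trans_lt hf1.lt_top).ne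
      rw [← ENNReal.toReal_le_toReal hf1 hf2]
      exact e.le
    exact (ae_eq_of_subset_of_measure_ge h1 ((measure_mono h2).trans hv)
      (isOpen_openBox 0 1).measurableSet.nullMeasurableSet
      (((measure_mono h2).trans_lt (isCompact_closedBox 0 1).measure_lt_top).ne)).symm
  let F : Finset (Fin 3 → ℤ) := Fintype.piFinset fun _ => Finset.Icc (-(n : ℤ) - 1) n
  let v : (Fin 3 → ℤ) → E3 := fun z => WithLp.toLp 2 fun i => (z i : ℝ)
  refine ⟨F.card, fun f => ?_⟩
  have hcov : Q ⊆ ⋃ z ∈ F, (fun x => x - v z) ⁻¹' H := by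
    intro x hx
    have hxn : ∀ i, |x i| ≤ n := fun i => by
      have h1 := hρ hx
      rw [mem_closedBall_zero_iff] at h1
      have h2 := PiLp.norm_apply_le x i
      rw [Real.norm_eq_abs] at h2
      linarith
    simp only [Set.mem_iUnion, exists_prop]
    refine ⟨fun i => ⌊x i⌋, ?_, ?_⟩
    · rw [Fintype.mem_piFinset]
      intro i
      have := abs_le.1 (hxn i)
      rw [Finset.mem_Icc]
      constructor
      · rw [Int.le_floor]; push_cast; linarith
      · have : (⌊x i⌋ : ℝ) ≤ n := (Int.floor_le _).trans this.2
        exact_mod_cast this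
    · intro i
      exact ⟨Int.fract_nonneg (x i), Int.fract_lt_one (x i)⟩
  have hpiece : ∀ z, ∫⁻ x in (fun x => x - v z) ⁻¹' H, f (fractVec x) = ∫⁻ x in openCell, f x := by
    intro z
    have e1 : ∫⁻ x in (fun x => x - v z) ⁻¹' H, f (fractVec x) =
        ∫⁻ x in (fun x => x - v z) ⁻¹' H, f (x - v z) := by
      refine setLIntegral_congr_fun (hHm.preimage (by fun_prop)) fun x hx => ?_
      have : floorVec x = v z := by
        ext i
        have hi := hx i
        simp only [v, PiLp.sub_apply, Set.mem_Ico] at hi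
        simp only [floorVec, v]
        norm_cast
        rw [Int.floor_eq_iff]
        constructor <;> linarith [hi.1, hi.2]
      simp only [fractVec, this]
    rw [e1, (measurePreserving_sub_right volume (v z)).setLIntegral_comp_preimage_emb
      (MeasurableEquiv.subRight (v z)).measurableEmbedding f H]
    exact setLIntegral_congr hHae
  calc ∫⁻ x in Q, f (fractVec x) ≤ ∫⁻ x in ⋃ z ∈ F, (fun x => x - v z) ⁻¹' H, f (fractVec x) :=
        lintegral_mono_set hcov
    _ ≤ ∑ z ∈ F, ∫⁻ x in (fun x => x - v z) ⁻¹' H, f (fractVec x) := by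
        induction F using Finset.induction_on with
        | empty => simp
        | insert z G hz ih =>
          rw [Finset.set_biUnion_insert, Finset.sum_insert hz]
          exact (lintegral_union_le _ _ _).trans (by gcongr)
    _ = F.card * ∫⁻ x in openCell, f x := by
        rw [Finset.sum_congr rfl fun z _ => hpiece z, Finset.sum_const, nsmul_eq_mul]

/-! ### Smooth functions as Sobolev functions -/

theorem memLp_two_of_continuous {F : Type*} [NormedAddCommGroup F] {f : E3 → F}
    [SecondCountableTopologyEither E3 F] (hf : Continuous f)
    {Q : Set E3} (hQ : IsCompact Q) : MemLp f 2 (volume.restrict Q) := by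
  have : IsFiniteMeasure (volume.restrict Q) := ⟨by simpa using hQ.measure_lt_top⟩
  obtain ⟨C, hC⟩ := hQ.exists_bound_of_continuousOn hf.continuousOn
  exact MemLp.of_bound hf.aestronglyMeasurable C (ae_restrict_of_forall_mem hQ.measurableSet hC)

/-- The Jacobian of a smooth function is its weak gradient. -/
theorem memW12Loc_of_contDiff {u : E3 → E3} (hu : ContDiff ℝ ∞ u) : MemW12Loc u (gradM u) := by
  have hg := continuous_gradM hu
  have hge : ∀ i k : Fin 3, Continuous fun x => gradM u x i k := fun i k =>
    (continuous_apply k).comp ((continuous_apply i).comp hg)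
  refine ⟨⟨hu.continuous.locallyIntegrable, fun i k => (hge i k).locallyIntegrable, ?_⟩,
    fun Q hQ => ⟨memLp_two_of_continuous hu.continuous hQ, fun i k =>
      memLp_two_of_continuous (hge i k) hQ⟩⟩
  intro φ hφ hφc i k
  have hui : ContDiff ℝ ∞ fun x => u x i :=
    (EuclideanSpace.proj i : E3 →L[ℝ] ℝ).contDiff.comp hu
  have hfd : ∀ x, fderiv ℝ (fun x => u x i) x (EuclideanSpace.single k 1) = gradM u x i k := by
    intro x
    have h1 := (EuclideanSpace.proj i : E3 →L[ℝ] ℝ).hasFDerivAt.comp x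
      ((hu.differentiable (by simp)) x).hasFDerivAt
    have h2 : fderiv ℝ (fun x => u x i) x = _ := h1.fderiv
    rw [h2, gradM_apply]
    rfl
  have hφ' : Continuous fun x => fderiv ℝ φ x (EuclideanSpace.single k 1) :=
    (hφ.continuous_fderiv (by simp)).clm_apply continuous_const
  have hφ'c : HasCompactSupport fun x => fderiv ℝ φ x (EuclideanSpace.single k 1) :=
    hφc.fderiv_apply (𝕜 := ℝ) _
  have := integral_mul_fderiv_eq_neg_fderiv_mul_of_integrable (μ := (volume : Measure E3))
    (f := fun x => u x i) (g := φ)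
    (v := EuclideanSpace.single k 1)
    (by simp only [hfd]
        exact ((hge i k).mul hφ.continuous).integrable_of_hasCompactSupport hφc.mul_left)
    ((hui.continuous.mul hφ').integrable_of_hasCompactSupport hφ'c.mul_left)
    ((hui.continuous.mul hφ.continuous).integrable_of_hasCompactSupport hφc.mul_left)
    (fun x _ => hui.differentiable (by simp) x) (fun x _ => hφ.differentiable (by simp) x)
  rw [this]
  simp only [hfd]

/-! ### From energy bounds to approximate solutions -/

theorem norm_entry_le (M : M3) (i k : Fin 3) : ‖M i k‖ ≤ ‖M‖ := by
  have h : ‖M i k‖ ^ 2 ≤ ‖M‖ ^ 2 := by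
    rw [frobenius_norm_sq, Matrix.trace]
    simp only [Matrix.diag_apply, Matrix.mul_apply, Matrix.transpose_apply, Real.norm_eq_abs, sq_abs]
    calc M i k ^ 2 = M i k * M i k := sq _
      _ ≤ ∑ j, M j k * M j k := Finset.single_le_sum (f := fun j => M j k * M j k)
          (fun j _ => mul_self_nonneg _) (Finset.mem_univ i)
      _ ≤ _ := Finset.single_le_sum (f := fun k => ∑ j, M j k * M j k)
          (fun k _ => Finset.sum_nonneg fun j _ => mul_self_nonneg _) (Finset.mem_univ k)
  exact (pow_le_pow_iff_left₀ (norm_nonneg _) (norm_nonneg _) two_ne_zero).1 h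

theorem eLpNorm_three_le {F : Type*} [NormedAddCommGroup F] {μ : Measure E3} {f : E3 → F}
    {g : E3 → ℝ} (hfg : ∀ x, ‖f x‖ ≤ g x) {c : ENNReal}
    (h : ∫⁻ x, ENNReal.ofReal (g x ^ 3) ∂μ ≤ c) : eLpNorm f 3 μ ≤ c ^ (1 / 3 : ℝ) := by
  rw [eLpNorm_eq_lintegral_rpow_enorm_toReal (by norm_num) (by norm_num)]
  simp only [ENNReal.toReal_ofNat]
  gcongr
  refine le_trans (lintegral_mono fun x => ?_) h
  rw [show (3 : ℝ) = (3 : ℕ) by norm_num, ENNReal.rpow_natCast, ← ofReal_norm,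
    ← ENNReal.ofReal_pow (norm_nonneg _)]
  exact ENNReal.ofReal_le_ofReal (pow_le_pow_left₀ (norm_nonneg _) (hfg x) 3)

/-- A family bounded in `L³` is `L²`-equi-integrable. -/
theorem unifIntegrable_two_of_bounded_three {μ : Measure E3} {f : ℕ → E3 → ℝ}
    (hf : ∀ j, AEStronglyMeasurable (f j) μ) {c : ℝ≥0} (hc : ∀ j, eLpNorm (f j) 3 μ ≤ c) :
    UnifIntegrable f 2 μ := by
  intro ε hε
  have hexp : (0 : ℝ) < 1 / 2 - 1 / 3 := by norm_num
  have hlim : Tendsto (fun δ : ℝ => (c : ENNReal) * ENNReal.ofReal δ ^ (1 / 2 - 1 / 3 : ℝ)) (𝓝[>] 0)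
      (𝓝 0) := by
    have h1 : Tendsto (fun δ : ℝ => ENNReal.ofReal δ) (𝓝[>] 0) (𝓝 0) := by
      have := (ENNReal.continuous_ofReal.tendsto 0).mono_left
        (nhdsWithin_le_nhds (s := Set.Ioi (0 : ℝ)))
      simpa using this
    have h2 := (ENNReal.continuous_rpow_const (y := (1 / 2 - 1 / 3 : ℝ))).tendsto 0 |>.comp h1
    rw [ENNReal.zero_rpow_of_pos hexp] at h2
    have h3 := ENNReal.Tendsto.const_mul (a := (c : ENNReal)) h2 (Or.inr ENNReal.coe_ne_top)
    simpa using h3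
  obtain ⟨δ, hδ, hδ0⟩ := ((hlim.eventually (gt_mem_nhds (ENNReal.ofReal_pos.2 hε))).and
    eventually_mem_nhdsWithin).exists
  refine ⟨δ, hδ0, fun j t ht htδ => ?_⟩
  rw [eLpNorm_indicator_eq_eLpNorm_restrict ht]
  have h1 := eLpNorm_le_eLpNorm_mul_rpow_measure_univ (μ := μ.restrict t) (p := 2) (q := 3)
    (by norm_num) (hf j).restrict
  rw [Measure.restrict_apply_univ] at h1
  simp only [ENNReal.toReal_ofNat] at h1
  refine h1.trans (le_trans ?_ hδ.le)
  gcongr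
  exact (eLpNorm_mono_measure _ Measure.restrict_le_self).trans (hc j)

/-- A matrix `A` at which the infimum of the cubic energy `e |M|³ + dist(M, K(S))³` is
of order `e` belongs to `K^app(S)`: nearly optimal perturbations for `e → 0`, periodized, are
bounded in `W^{1,3}` and their distance to `K(S)` tends to zero in `L³`. -/
theorem mem_KApp_of_energyBound {S A : M3} (hA : A.IsSymm) {C : ℝ}
    (h : ∀ e > 0, IsEnergyBound (cubicEnergy S e) A (e * C)) : A ∈ KApp S := by
  have hC0 : 0 ≤ C := by
    have := (h 1 one_pos).nonneg (cubicEnergy_nonneg S zero_le_one)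
    linarith
  have hcellb : Bornology.IsBounded openCell :=
    (isCompact_closedBox 0 1).isBounded.subset (openBox_subset_closedBox 0 1)
  have hcellv : volume.real openCell = 1 := by
    rw [openCell, volume_openBox zero_le_one]; simp
  let e : ℕ → ℝ := fun j => 1 / ((j : ℝ) + 1)
  have he : ∀ j, 0 < e j := fun j => by positivity
  have hex : ∀ j, ∃ φ : E3 → E3, ContDiff ℝ ∞ φ ∧ tsupport φ ⊆ openCell ∧ (∀ x, ‖φ x‖ ≤ 1) ∧
      ∫ x in openCell, cubicEnergy S (e j) (A + gradM φ x) ≤ e j * (C + 1) := by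
    intro j
    have he1 : e j ≤ 1 := by
      simp only [e]; rw [div_le_one (by positivity)]; linarith [Nat.cast_nonneg (α := ℝ) j]
    obtain ⟨φ, h1, h2, h3, h4⟩ := (h (e j) (he j)).fill (continuous_cubicEnergy S _)
      (cubicEnergy_nonneg S (he j).le) (isOpen_openBox 0 1) hcellb (he j)
    refine ⟨φ, h1, h2, fun x => (h3 x).trans he1, h4.trans (le_of_eq ?_)⟩
    rw [show volume.real (openBox 0 1) = 1 from hcellv]
    ring
  choose φ hφ hs hb hE using hex
  have hc : ∀ j, HasCompactSupport (φ j) := fun j =>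
    HasCompactSupport.of_support_subset_isCompact (isCompact_closedBox 0 1)
      ((subset_tsupport _).trans ((hs j).trans (openBox_subset_closedBox 0 1)))
  let u : ℕ → E3 → E3 := fun j x => linField A x + φ j (fractVec x)
  have hu : ∀ j, ContDiff ℝ ∞ (u j) := fun j =>
    (contDiff_linField A).add (contDiff_periodization (hφ j) (hs j) (hc j))
  let g : ℕ → E3 → M3 := fun j x => A + gradM (φ j) x
  have hgc : ∀ j, Continuous (g j) := fun j => continuous_const.add (continuous_gradM (hφ j))
  have hgrad : ∀ j x, gradM (u j) x = g j (fractVec x) := by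
    intro j x
    rw [gradM_add (contDiff_linField A) (contDiff_periodization (hφ j) (hs j) (hc j)),
      gradM_linField, gradM_periodization (hs j) (hc j)]
  have hGc : ∀ j, Continuous (gradM (u j)) := fun j => continuous_gradM (hu j)
  have hentc : ∀ j (i k : Fin 3), Continuous fun x => gradM (u j) x i k := fun j i k =>
    (continuous_apply k).comp ((continuous_apply i).comp (hGc j))
  have hdc : ∀ j, Continuous fun x => Metric.infDist (gradM (u j) x) (KSet S) := fun j =>
    (Metric.continuous_infDist_pt _).comp (hGc j)
  have hint : ∀ j (f : M3 → ℝ), Continuous f → IntegrableOn (fun x => f (g j x)) openCell :=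
    fun j f hf => integrableOn_energy hf A (hφ j) hcellb
  have hle : ∀ j (f : M3 → ℝ), Continuous f → (∀ M, 0 ≤ f M) →
      (∀ M, f M ≤ cubicEnergy S (e j) M) →
      ∫⁻ x in openCell, ENNReal.ofReal (f (g j x)) ≤ ENNReal.ofReal (e j * (C + 1)) := by
    intro j f hf hf0 hfW
    rw [← ofReal_integral_eq_lintegral_ofReal (hint j f hf) (ae_of_all _ fun x => hf0 _)]
    refine ENNReal.ofReal_le_ofReal (le_trans ?_ (hE j))
    exact integral_mono (hint j f hf) (hint j _ (continuous_cubicEnergy S _)) fun x => hfW _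
  have hnorm : ∀ j, ∫⁻ x in openCell, ENNReal.ofReal (‖g j x‖ ^ 3) ≤ ENNReal.ofReal (C + 1) := by
    intro j
    have h1 := hle j (fun M => e j * ‖M‖ ^ 3) (by fun_prop)
      (fun M => by have := he j; positivity) (fun M => by
        have := Metric.infDist_nonneg (x := M) (s := KSet S)
        unfold cubicEnergy
        linarith [pow_nonneg this 3])
    simp only [ENNReal.ofReal_mul (he j).le] at h1
    rw [lintegral_const_mul' _ _ ENNReal.ofReal_ne_top] at h1
    exact (ENNReal.mul_le_mul_iff_right (ENNReal.ofReal_pos.2 (he j)).ne' ENNReal.ofReal_ne_top).1 h1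
  have hdist : ∀ j, ∫⁻ x in openCell, ENNReal.ofReal (Metric.infDist (g j x) (KSet S) ^ 3) ≤
      ENNReal.ofReal (e j * (C + 1)) := by
    intro j
    have hcd := Metric.continuous_infDist_pt (KSet S)
    refine hle j (fun M => Metric.infDist M (KSet S) ^ 3) (by fun_prop)
      (fun M => pow_nonneg Metric.infDist_nonneg 3) (fun M => ?_)
    have := he j
    have h2 : 0 ≤ e j * ‖M‖ ^ 3 := by positivity
    unfold cubicEnergy
    linarith
  have hL3 : ∀ Q : Set E3, IsCompact Q → ∃ c : ℝ≥0, ∀ j (i k : Fin 3),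
      eLpNorm (fun x => gradM (u j) x i k) 3 (volume.restrict Q) ≤ c := by
    intro Q hQ
    obtain ⟨N, hN⟩ := exists_lintegral_fractVec_le hQ
    have hfin : ((N : ENNReal) * ENNReal.ofReal (C + 1)) ^ (1 / 3 : ℝ) ≠ ⊤ :=
      ENNReal.rpow_ne_top_of_nonneg (by norm_num)
        (ENNReal.mul_ne_top (ENNReal.natCast_ne_top N) ENNReal.ofReal_ne_top)
    refine ⟨(((N : ENNReal) * ENNReal.ofReal (C + 1)) ^ (1 / 3 : ℝ)).toNNReal, fun j i k => ?_⟩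
    rw [ENNReal.coe_toNNReal hfin]
    refine eLpNorm_three_le (g := fun x => ‖g j (fractVec x)‖)
      (fun x => by rw [hgrad]; exact norm_entry_le _ i k) ?_
    exact (hN fun y => ENNReal.ofReal (‖g j y‖ ^ 3)).trans (by gcongr; exact hnorm j)
  refine ⟨hA, u, fun j => gradM (u j), fun j => ⟨memW12Loc_of_contDiff (hu j), fun i => ?_⟩, ?_, ?_, ?_⟩
  · refine ae_of_all _ fun x => ?_
    simp only [u, add_sub_cancel_left, fractVec_add_single]
  · intro Q hQ
    obtain ⟨c, hc⟩ := hL3 Q hQ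
    have hQfin : volume Q ≠ ⊤ := hQ.measure_lt_top.ne
    obtain ⟨D, hD⟩ := hQ.exists_bound_of_continuousOn (contDiff_linField A).continuous.continuousOn
    set c₁ : ENNReal := volume Q ^ (2 : ENNReal).toReal⁻¹ * ENNReal.ofReal (D + 1) with hc₁
    set c₂ : ENNReal := c * volume Q ^ (1 / (2 : ENNReal).toReal - 1 / (3 : ENNReal).toReal) with hc₂
    have hc₁f : c₁ ≠ ⊤ := ENNReal.mul_ne_top
      (ENNReal.rpow_ne_top_of_nonneg (by simp) hQfin) ENNReal.ofReal_ne_top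
    have hc₂f : c₂ ≠ ⊤ := ENNReal.mul_ne_top ENNReal.coe_ne_top
      (ENNReal.rpow_ne_top_of_nonneg (by norm_num) hQfin)
    refine ⟨(c₁ + c₂).toNNReal, fun j => ?_⟩
    rw [ENNReal.coe_toNNReal (ENNReal.add_ne_top.2 ⟨hc₁f, hc₂f⟩)]
    constructor
    · refine le_trans ?_ le_self_add
      have := eLpNorm_le_of_ae_bound (p := 2) (μ := volume.restrict Q) (f := u j) (C := D + 1)
        (ae_restrict_of_forall_mem hQ.measurableSet fun x hx =>
          (norm_add_le _ _).trans (add_le_add (hD x hx) (hb j _)))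
      rwa [Measure.restrict_apply_univ] at this
    · intro i k
      refine le_trans ?_ le_add_self
      have := eLpNorm_le_eLpNorm_mul_rpow_measure_univ (μ := volume.restrict Q) (p := 2) (q := 3)
        (by norm_num) (hentc j i k).aestronglyMeasurable
      rw [Measure.restrict_apply_univ] at this
      exact this.trans (by rw [hc₂]; gcongr; exact hc j i k)
  · intro Q hQ i k
    obtain ⟨c, hc⟩ := hL3 Q hQ
    exact unifIntegrable_two_of_bounded_three (fun j => (hentc j i k).aestronglyMeasurable)
      fun j => hc j i k
  · intro Q hQ
    obtain ⟨N, hN⟩ := exists_lintegral_fractVec_le hQ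
    refine tendstoInMeasure_of_tendsto_eLpNorm (p := 3) (by norm_num)
      (fun j => (hdc j).aestronglyMeasurable) aestronglyMeasurable_const ?_
    have hbound : ∀ j, eLpNorm ((fun x => Metric.infDist (gradM (u j) x) (KSet S)) - fun _ => (0 : ℝ)) 3
        (volume.restrict Q) ≤ ((N : ENNReal) * ENNReal.ofReal (e j * (C + 1))) ^ (1 / 3 : ℝ) := by
      intro j
      refine eLpNorm_three_le (g := fun x => Metric.infDist (g j (fractVec x)) (KSet S))
        (fun x => ?_) ?_
      · simp only [Pi.sub_apply, sub_zero, hgrad, Real.norm_eq_abs]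
        rw [abs_of_nonneg Metric.infDist_nonneg]
      · exact (hN fun y => ENNReal.ofReal (Metric.infDist (g j y) (KSet S) ^ 3)).trans
          (by gcongr; exact hdist j)
    have he0 : Tendsto (fun j => ENNReal.ofReal (e j * (C + 1))) atTop (𝓝 0) := by
      have h1 : Tendsto (fun j => e j * (C + 1)) atTop (𝓝 (0 * (C + 1))) :=
        tendsto_one_div_add_atTop_nhds_zero_nat.mul_const _
      rw [zero_mul] at h1
      have := (ENNReal.continuous_ofReal.tendsto 0).comp h1
      rwa [ENNReal.ofReal_zero] at this
    have hlim : Tendsto (fun j => ((N : ENNReal) * ENNReal.ofReal (e j * (C + 1))) ^ (1 / 3 : ℝ))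
        atTop (𝓝 0) := by
      have h1 := ENNReal.Tendsto.const_mul (a := (N : ENNReal)) he0
        (Or.inr (ENNReal.natCast_ne_top N))
      rw [mul_zero] at h1
      have h2 := (ENNReal.continuous_rpow_const (y := (1 / 3 : ℝ))).tendsto 0 |>.comp h1
      rwa [ENNReal.zero_rpow_of_pos (by norm_num)] at h2
    exact tendsto_of_tendsto_of_tendsto_of_le_of_le tendsto_const_nhds hlim
      (fun _ => zero_le) hbound

/-! ### Normalization and conclusion -/

theorem IsDiagonalWithEigenvalues.unique {T : M3} {t t' : Fin 3 → ℝ}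
    (h : IsDiagonalWithEigenvalues T t) (h' : IsDiagonalWithEigenvalues T t') : t = t' := by
  obtain ⟨⟨σ, hσ⟩, h1, h2⟩ := h
  obtain ⟨⟨σ', hσ'⟩, h1', h2'⟩ := h'
  have mono : ∀ f : Fin 3 → ℝ, f 0 ≤ f 1 → f 1 ≤ f 2 → Monotone f := by
    intro f a b
    refine Fin.monotone_iff_le_succ.2 fun i => ?_
    fin_cases i
    · exact a
    · exact b
  have e : t ∘ σ = t' ∘ σ' := Matrix.diagonal_injective (hσ.symm.trans hσ')
  have e' : t = t' ∘ (σ.symm.trans σ') := by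
    ext i
    have := congrFun e (σ.symm i)
    simpa using this
  have m1 := mono t h1 h2
  rw [e'] at m1
  have m2 : Monotone (t' ∘ (Equiv.refl (Fin 3))) := by simpa using mono t' h1' h2'
  have c1 := Tuple.comp_sort_eq_comp_iff_monotone.2 m1
  have c2 := Tuple.comp_sort_eq_comp_iff_monotone.2 m2
  rw [e', c1, ← c2]
  rfl

/-- The formula for the third eigenvalue in polynomial form. The denominator of `F` cannot vanish,
since the value of `F` would then be zero. -/
theorem relation_of_eq_FF {s : Fin 3 → ℝ} (h1 : 0 < s 1) {x y z : ℝ} (hz : 0 < z)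
    (h : z = FF s x y) :
    s 1 * z * ((x / s 1) ^ 2 + x / s 1 * (y / s 1) + (y / s 1) ^ 2 - x / s 1 - y / s 1) =
      s 0 * s 2 * (x / s 1 * (y / s 1)) := by
  have hD : x ^ 2 + x * y + y ^ 2 - s 1 * (x + y) ≠ 0 := by
    intro h0
    rw [FF, h0, div_zero, mul_zero] at h
    exact hz.ne' h
  have h2 : z * (s 1 * (x ^ 2 + x * y + y ^ 2 - s 1 * (x + y))) = s 0 * s 2 * (x * y) := by
    rw [h, FF]
    generalize x ^ 2 + x * y + y ^ 2 - s 1 * (x + y) = D at hD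
    field_simp
  field_simp
  linear_combination h2

/-- `λ₁ = λ₂ = 1` would force `(s₂ - s₁) (s₃ - s₂) = 0`. -/
theorem not_relation_one_one {s : Fin 3 → ℝ} (hs₁ : s 0 < s 1) (hs₂ : s 1 < s 2)
    (hsum : s 0 + s 1 + s 2 = 1) {z : ℝ} (htr : 1 * s 1 + 1 * s 1 + z = 1)
    (hrel : s 1 * z * ((1 : ℝ) ^ 2 + 1 * 1 + 1 ^ 2 - 1 - 1) = s 0 * s 2 * (1 * 1)) : False := by
  have : (s 1 - s 0) * (s 2 - s 1) = 0 := by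
    linear_combination hrel - s 1 * htr + s 1 * hsum
  exact (mul_pos (sub_pos.2 hs₁) (sub_pos.2 hs₂)).ne' this

theorem IsLambdaPair.exists_isAdmissible {s t : Fin 3 → ℝ} (hs₀ : 0 < s 0) (hs₁ : s 0 < s 1)
    (hs₂ : s 1 < s 2) (hsum : s 0 + s 1 + s 2 = 1) (ht01 : t 0 ≤ t 1) (ht12 : t 1 ≤ t 2)
    (ht0 : s 0 ≤ t 0) (ht2 : t 2 ≤ s 2) (htsum : t 0 + t 1 + t 2 = 1) {l m : ℝ}
    (h : IsLambdaPair s t l m) :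
    ∃ z, IsAdmissible s l m z ∧
      (Matrix.diagonal t).charpoly = (Matrix.diagonal ![l * s 1, m * s 1, z]).charpoly := by
  have p1 : 0 < s 1 := by linarith
  have p2 : 0 < s 2 := by linarith
  have q0 : 0 < t 0 := by linarith
  have q1 : 0 < t 1 := by linarith
  have q2 : 0 < t 2 := by linarith
  rcases h with ⟨⟨ha, hb, hF⟩, rfl, rfl⟩ | ⟨⟨ha, hb, hF⟩, rfl, rfl⟩
  · have ha' : t 1 / s 2 ≤ t 0 / s 1 := ha ▸ le_max_right _ _
    have hb' : t 1 / s 1 ≤ t 2 / s 2 := hb ▸ min_le_right _ _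
    have hrel := relation_of_eq_FF p1 q2 hF
    have e0 : t 0 / s 1 * s 1 = t 0 := div_mul_cancel₀ _ p1.ne'
    have e1 : t 1 / s 1 * s 1 = t 1 := div_mul_cancel₀ _ p1.ne'
    have hm1 : t 1 / s 1 ≤ 1 := hb'.trans (by rw [div_le_one p2]; exact ht2)
    have hlm : t 0 / s 1 ≤ t 1 / s 1 := by gcongr
    have htr : t 0 / s 1 * s 1 + t 1 / s 1 * s 1 + t 2 = 1 := by rw [e0, e1]; exact htsum
    refine ⟨t 2, ⟨by positivity, by positivity, q2, htr, hrel,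
      Or.inl ⟨lt_of_le_of_ne (hlm.trans hm1) ?_, hlm, hm1, ?_, ?_⟩⟩, ?_⟩
    · intro hl1
      have hm1' : t 1 / s 1 = 1 := le_antisymm hm1 (hl1 ▸ hlm)
      rw [hl1, hm1'] at hrel htr
      exact not_relation_one_one hs₁ hs₂ hsum htr hrel
    · rw [e1]; exact (div_le_iff₀ p2).1 ha'
    · exact (le_div_iff₀ p2).1 (hlm.trans hb')
    · rw [e0, e1]
      congr 2
      ext i; fin_cases i <;> rfl
  · have ha' : t 0 / s 0 ≤ t 1 / s 1 := ha ▸ le_max_left _ _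
    have hb' : t 2 / s 1 ≤ t 1 / s 0 := hb ▸ min_le_left _ _
    have hrel := relation_of_eq_FF p1 q0 hF
    have e2 : t 2 / s 1 * s 1 = t 2 := div_mul_cancel₀ _ p1.ne'
    have e1 : t 1 / s 1 * s 1 = t 1 := div_mul_cancel₀ _ p1.ne'
    have hm1 : 1 ≤ t 1 / s 1 := le_trans (by rw [one_le_div hs₀]; exact ht0) ha'
    have hlm : t 1 / s 1 ≤ t 2 / s 1 := by gcongr
    have htr : t 2 / s 1 * s 1 + t 1 / s 1 * s 1 + t 0 = 1 := by rw [e2, e1]; linarith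
    refine ⟨t 0, ⟨by positivity, by positivity, q0, htr, hrel,
      Or.inr ⟨lt_of_le_of_ne (hm1.trans hlm) ?_, hlm, hm1, ?_, ?_⟩⟩, ?_⟩
    · intro hl1
      have hm1' : t 1 / s 1 = 1 := le_antisymm (hl1.symm ▸ hlm) hm1
      rw [← hl1, hm1'] at hrel htr
      exact not_relation_one_one hs₁ hs₂ hsum htr hrel
    · rw [e1]; exact (le_div_iff₀ hs₀).1 hb'
    · exact (div_le_iff₀ hs₀).1 (ha'.trans hlm)
    · rw [e2, e1, Matrix.charpoly_diagonal, Matrix.charpoly_diagonal, Fin.prod_univ_three,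
        Fin.prod_univ_three]
      simp only [Matrix.cons_val_zero, Matrix.cons_val_one, Matrix.cons_val]
      ring

/-- The quadratic form of `M` lies between `a |w|²` and `b |w|²`. -/
def FormBetween (M : M3) (a b : ℝ) : Prop :=
  ∀ w : Fin 3 → ℝ, a * (w ⬝ᵥ w) ≤ w ⬝ᵥ M *ᵥ w ∧ w ⬝ᵥ M *ᵥ w ≤ b * (w ⬝ᵥ w)

theorem formBetween_diagonal {d : Fin 3 → ℝ} {a b : ℝ} (h : ∀ i, d i ∈ Set.Icc a b) :
    FormBetween (Matrix.diagonal d) a b := by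
  intro w
  simp only [dotProduct, Matrix.mulVec_diagonal, Finset.mul_sum]
  constructor
  · refine Finset.sum_le_sum fun i _ => ?_
    nlinarith [(h i).1, mul_self_nonneg (w i)]
  · refine Finset.sum_le_sum fun i _ => ?_
    nlinarith [(h i).2, mul_self_nonneg (w i)]

theorem FormBetween.conj {M : M3} {a b : ℝ} (h : FormBetween M a b) {R : M3} (hR : R ∈ SO3) :
    FormBetween (Rᵀ * M * R) a b := by
  intro w
  have e1 : (R *ᵥ w) ⬝ᵥ (R *ᵥ w) = w ⬝ᵥ w := by
    rw [Matrix.dotProduct_mulVec, ← Matrix.mulVec_transpose, Matrix.mulVec_mulVec,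
      transpose_mul_self_of_mem_SO3 hR, Matrix.one_mulVec]
  have e2 : w ⬝ᵥ (Rᵀ * M * R) *ᵥ w = (R *ᵥ w) ⬝ᵥ M *ᵥ (R *ᵥ w) := by
    rw [← Matrix.mulVec_mulVec, ← Matrix.mulVec_mulVec, Matrix.dotProduct_mulVec w,
      Matrix.vecMul_transpose]
  rw [e2, ← e1]
  exact h _

theorem FormBetween.combine {M N : M3} {a b a' b' : ℝ} (h : FormBetween M a b)
    (h' : FormBetween N a' b') {p q : ℝ} (hp : 0 ≤ p) (hq : 0 ≤ q) :
    FormBetween (p • M + q • N) (p * a + q * a') (p * b + q * b') := by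
  intro w
  rw [Matrix.add_mulVec, Matrix.smul_mulVec, Matrix.smul_mulVec, dotProduct_add, dotProduct_smul,
    dotProduct_smul, smul_eq_mul, smul_eq_mul]
  constructor
  · nlinarith [mul_le_mul_of_nonneg_left (h w).1 hp, mul_le_mul_of_nonneg_left (h' w).1 hq]
  · nlinarith [mul_le_mul_of_nonneg_left (h w).2 hp, mul_le_mul_of_nonneg_left (h' w).2 hq]

theorem FormBetween.mem_Icc_of_diagonal {v : Fin 3 → ℝ} {a b : ℝ}
    (h : FormBetween (Matrix.diagonal v) a b) (i : Fin 3) : v i ∈ Set.Icc a b := by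
  have := h (Pi.single i 1)
  simpa using this

/-- A symmetric matrix of positive trace with energy of order `e` and quadratic form in the right
range belongs to `K^*(S)` after normalization and diagonalization. -/
theorem exists_smul_conj_mem_KStarSet {s : Fin 3 → ℝ} {A : M3} (hA : A.IsSymm)
    (htr : 0 < A.trace) (hform : FormBetween A (A.trace * s 0) (A.trace * s 2)) {C : ℝ}
    (hE : ∀ e > 0, IsEnergyBound (cubicEnergy (Matrix.diagonal s) e) A (e * C)) :
    ∃ R ∈ SO3, (1 / A.trace) • (Rᵀ * A * R) ∈ KStarSet s := by
  obtain ⟨R, hR, v, hv⟩ := exists_SO3_diagonal hA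
  refine ⟨R, hR, ?_, fun i => v i / A.trace, ?_, ?_, ?_⟩
  · have hinv : 0 < 1 / A.trace := by positivity
    refine mem_KApp_of_energyBound (C := (1 / A.trace) ^ 3 * C) ((isSymm_conj hA R).smul _) ?_
    intro e he
    refine (((hE e he).conj (cubicEnergy_conj _ e) hR).smul
      (fun M => cubicEnergy_smul _ e hinv M) hinv.le).mono (le_of_eq (by ring))
  · rw [hv]
    ext i j
    by_cases h : i = j
    · subst h; simp; ring
    · simp [h]
  · intro i
    have := (hv ▸ hform.conj hR).mem_Icc_of_diagonal i
    rw [Set.mem_Icc, le_div_iff₀ htr, div_le_iff₀ htr]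
    constructor <;> linarith [this.1, this.2]
  · have h1 := trace_conj hR A
    rw [hv, Matrix.trace_diagonal] at h1
    rw [← Finset.sum_div, h1, div_self htr.ne']

theorem mainTheorem4 (s : Fin 3 → ℝ) (hs₀ : 0 < s 0) (hs₁ : s 0 < s 1) (hs₂ : s 1 < s 2)
    (hsum : ∑ i, s i = 1)
    (T : M3) (hT : T ∈ T2 s) (t : Fin 3 → ℝ) (ht : IsDiagonalWithEigenvalues T t)
    (l₁ l₂ : ℝ) (hl : IsLambdaPair s t l₁ l₂) :
    (∃ (R₁ R₂ : M3) (n : E3), IsRankOneConnection (Matrix.diagonal s) T l₁ l₂ R₁ R₂ n) ∧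
    ∀ (R₁ R₂ : M3) (n : E3), IsRankOneConnection (Matrix.diagonal s) T l₁ l₂ R₁ R₂ n →
      ∀ A ∈ segment ℝ (l₁ • Matrix.diagonal s) (R₁ᵀ * T * R₁),
        ∃ R ∈ SO3, (1 / A.trace) • (Rᵀ * A * R) ∈ KStarSet s := by
  rw [Fin.sum_univ_three] at hsum
  obtain ⟨t', ht', hs0t, hts2, htsum, -⟩ := hT
  obtain rfl : t' = t := ht'.unique ht
  rw [Fin.sum_univ_three] at htsum
  obtain ⟨⟨σ, hσ⟩, h01, h12⟩ := ht
  obtain ⟨z, hadm, hchar⟩ := hl.exists_isAdmissible hs₀ hs₁ hs₂ hsum h01 h12 hs0t hts2 htsum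
  have hTs : T.IsSymm := hσ ▸ Matrix.isSymm_diagonal _
  have hTc : T.charpoly = (Matrix.diagonal ![l₁ * s 1, l₂ * s 1, z]).charpoly := by
    rw [hσ, charpoly_diagonal_comp_perm, hchar]
  refine ⟨hadm.exists_rankOneConnection hs₀ hs₁ hs₂ hsum hTs hTc, ?_⟩
  rintro R₁ R₂ n ⟨hR₁, -, hn, h1, -⟩ A ⟨a, b, ha, hb, hab, rfl⟩
  set S : M3 := Matrix.diagonal s with hS
  have hl₁ : 0 < l₁ := hadm.1
  have htrT : T.trace = 1 := by
    rw [hσ, Matrix.trace_diagonal, ← htsum, ← Fin.sum_univ_three]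
    exact Equiv.sum_comp σ t'
  have htrS : S.trace = 1 := by rw [hS, Matrix.trace_diagonal, Fin.sum_univ_three, hsum]
  have htrA : (a • l₁ • S + b • (R₁ᵀ * T * R₁)).trace = a * l₁ + b := by
    rw [Matrix.trace_add, Matrix.trace_smul, Matrix.trace_smul, Matrix.trace_smul,
      trace_conj hR₁, htrT, htrS]
    simp
  have hpos : 0 < a * l₁ + b := by
    rcases hb.eq_or_lt with h | h
    · have : a = 1 := by linarith
      rw [← h, this]; linarith
    · positivity
  have hformS : FormBetween S (s 0) (s 2) := by
    refine formBetween_diagonal fun i => ?_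
    fin_cases i <;> constructor <;> simp <;> linarith
  have hformT : FormBetween T (s 0) (s 2) := by
    rw [hσ]
    refine formBetween_diagonal fun i => ?_
    have : ∀ j, t' j ∈ Set.Icc (s 0) (s 2) := by
      intro j
      fin_cases j <;> constructor <;> simp <;> linarith
    exact this (σ i)
  have hform := hformS.combine (hformT.conj hR₁) (mul_nonneg ha hl₁.le) hb
  rw [← smul_smul, ← add_mul, ← add_mul, ← htrA] at hform
  have hsymm : (a • l₁ • S + b • (R₁ᵀ * T * R₁)).IsSymm :=
    (((Matrix.isSymm_diagonal s).smul l₁).smul a).add ((isSymm_conj hTs R₁).smul b)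
  set c := 4 * (‖S‖ ^ 3 / S.det) + 1 with hc
  refine exists_smul_conj_mem_KStarSet hsymm (by rw [htrA]; exact hpos) hform
    (C := a * (l₁ ^ 3 * ‖S‖ ^ 3) + b * c + 1) ?_
  intro e he
  have hinv := cubicEnergy_conj S e
  have b1 : IsEnergyBound (cubicEnergy S e) (l₁ • S) (l₁ ^ 3 * (e * ‖S‖ ^ 3)) := by
    rw [← cubicEnergy_self]
    exact (isEnergyBound_self _ S).smul (fun M => cubicEnergy_smul S e hl₁ M) hl₁.le
  have b2 : IsEnergyBound (cubicEnergy S e) (R₁ᵀ * T * R₁) (e * c) :=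
    (hadm.energyBound hs₀ hs₁ hs₂ hsum hTs hTc he).conj hinv hR₁
  rcases ha.eq_or_lt with h | ha'
  · have hb1 : b = 1 := by linarith
    rw [← h, hb1, zero_smul, zero_add, one_smul]
    exact b2.mono (by nlinarith)
  rcases hb.eq_or_lt with h | hb'
  · have ha1 : a = 1 := by linarith
    rw [← h, ha1, zero_smul, add_zero, one_smul]
    exact b1.mono (by nlinarith)
  have b3 := IsEnergyBound.laminate (continuous_cubicEnergy S e) (cubicEnergy_nonneg S he.le) hinv
    hn (c := -(1 - l₁)) (B := l₁ • S) (C := R₁ᵀ * T * R₁) (by rw [h1]; module) ha' (by linarith)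
    b1 b2 he
  rw [show 1 - a = b by linarith] at b3
  exact b3.mono (le_of_eq (by ring))
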